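/- Let $n\ge 2$ and $s\in(0,1)$, and write $x=(x',x_n)\in\mathbb R^{n-1}\times\mathbb R$. For measurable $E\subset\mathbb R^n$ and open $U\subset\mathbb R^n$ let $$P_s(E;U)=\int_{E\cap U}\int_{E^c}\frac{dx\,dy}{|x-y|^{n+s}}+\int_{E\cap U^c}\int_{U\cap E^c}\frac{dx\,dy}{|x-y|^{n+s}}\in[0,\infty].$$ A measurable set $E$ is an $s$-minimizer in an open set $\Omega$ if $P_s(E;U)\le P_s(F;U)$ for every bounded open set $U\subset\Omega$ with Lipschitz boundary and every measurable $F$ with $F\setminus U=E\setminus U$. Let $\Omega=\{|x'|<1\}$ be the vertical unit cylinder and, for $M>0$, let $E_0=\{|x_n|>M\}$ be the complement of a slab. Theorem. There is $M_0\in(0,1)$, depending only on $n$ and $s$, such that for every $M\in(0,M_0)$ there exists an $s$-minimizer $E_M$ in $\Omega$ with $E_M\setminus\Omega=E_0\setminus\Omega$, and every such $s$-minimizer contains $\Omega$ up to a set of Lebesgue measure zero. With the usual choice of representative (a set contains every point $x$ such that $|B_r(x)\setminus E_M|=0$ for some $r>0$, and no point $x$ such that $|B_r(x)\cap E_M|=0$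 for some $r>0$), such a minimizer exists, and every such minimizer satisfies $\Omega\subset E_M$ and is connected. -/

import Mathlib

open MeasureTheory

noncomputable section

/-- The interaction `∫_A ∫_B dx dy / |x - y|^{n+s}` of two subsets of `ℝⁿ`, with values
in `[0, ∞]`. -/
def interaction {n : ℕ} (s : ℝ) (A B : Set (EuclideanSpace ℝ (Fin n))) : ENNReal :=
  ∫⁻ x in A, ∫⁻ y in B, ENNReal.ofReal (1 / ‖x - y‖ ^ ((n : ℝ) + s))

/-- The `s`-perimeter of `E` in `Ω`. -/
def sPerimeter {n : ℕ} (s : ℝ) (E Ω : Set (EuclideanSpace ℝ (Fin n))) : ENNReal :=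
  interaction s (E ∩ Ω) Eᶜ + interaction s (E ∩ Ωᶜ) (Ω ∩ Eᶜ)

/-- `U` has Lipschitz boundary: near each boundary point `p` there are a unit vector `ν` and a
Lipschitz function `g` such that `U` is the region strictly below the graph of `g` in the
direction `ν`. Here `x - ⟪ν, x⟫ ν` is the orthogonal projection of `x` to the hyperplane
`ν^⊥`, so only the values of `g` on this hyperplane matter. -/
def HasLipschitzBoundary {n : ℕ} (U : Set (EuclideanSpace ℝ (Fin n))) : Prop :=
  ∀ p ∈ frontier U, ∃ (ν : EuclideanSpace ℝ (Fin n)) (r : ℝ) (K : NNReal)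
    (g : EuclideanSpace ℝ (Fin n) → ℝ), ‖ν‖ = 1 ∧ 0 < r ∧ LipschitzWith K g ∧
      ∀ x ∈ Metric.ball p r, (x ∈ U ↔ inner ℝ ν x < g (x - (inner ℝ ν x) • ν))

/-- `E` is an `s`-minimizer in `Ω`: it is Lebesgue measurable, and in every bounded open
Lipschitz set `U ⊆ Ω` its `s`-perimeter is at most that of any measurable competitor which agrees
with `E` outside `U`. -/
def IsSMinimizer {n : ℕ} (s : ℝ) (Ω E : Set (EuclideanSpace ℝ (Fin n))) : Prop :=
  NullMeasurableSet E volume ∧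
    ∀ U : Set (EuclideanSpace ℝ (Fin n)), IsOpen U → Bornology.IsBounded U →
      HasLipschitzBoundary U → U ⊆ Ω →
      ∀ F : Set (EuclideanSpace ℝ (Fin n)), NullMeasurableSet F volume → F \ U = E \ U →
        sPerimeter s E U ≤ sPerimeter s F U

/-- The usual convention on the choice of `E` in its class modulo null sets: `E` contains its
measure-theoretic interior and is disjoint from its measure-theoretic exterior. -/
def IsNormalizedSet {n : ℕ} (E : Set (EuclideanSpace ℝ (Fin n))) : Prop :=
  (∀ x, (∃ r : ℝ, 0 < r ∧ volume (Metric.ball x r \ E) = 0) → x ∈ E) ∧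
    ∀ x, (∃ r : ℝ, 0 < r ∧ volume (Metric.ball x r ∩ E) = 0) → x ∉ E

/-- The horizontal part `x' ∈ ℝᵐ` of a point `x = (x', x_n)` of `ℝⁿ`, `n = m + 1`. -/
def horizontalPart {m : ℕ} (x : EuclideanSpace ℝ (Fin (m + 1))) : EuclideanSpace ℝ (Fin m) :=
  WithLp.toLp 2 (fun i : Fin m => x i.castSucc)

/-- The vertical unit cylinder `{|x'| < 1}` in `ℝⁿ`, `n = m + 1`. -/
def unitCylinder (m : ℕ) : Set (EuclideanSpace ℝ (Fin (m + 1))) :=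
  {x | ‖horizontalPart x‖ < 1}

/-- The complement `{|x_n| > M}` of the slab of half-width `M` in `ℝⁿ`, `n = m + 1`. -/
def slabComplement (m : ℕ) (M : ℝ) : Set (EuclideanSpace ℝ (Fin (m + 1))) :=
  {x | M < |x (Fin.last m)|}

end

/-! Write Ω for the cylinder, S for the slab complement, K for the kernel and n = m + 1. The proof
is a calibration argument. Inside Ω consider the growing family {|x_n| > t} with t decreasing to M,
followed by S ∪ {|x'| < r} with r increasing to 1. `calibrationWeight` records which of two points
is reached first. Between points of the slab it carries the extra factor |y'|, which tames the
curvature r^{-s} of thin cylinders near the axis. For M small, each x in Ω sees more mass already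
reached than not yet reached, with a uniform gain δ > 0 (`exists_calibration_inequality`). In the
slab this holds because S contributes at least a multiple of M^{-s}, while the error from the
cylinders is bounded. Off the slab, reflection in the height of x gives it.

Integrating over G ⊆ Ω, the weights on G × G cancel by symmetry, and
`interaction_add_le_of_calibration` results: adding G to a set that contains the rest of Ω ∪ S
lowers the perimeter by at least δ|G|. Hence Ω ∪ S is a minimizer.

For uniqueness, fill an arbitrary minimizer E in a truncated cylinder U. This gives δ|U \ E| ≤ 2 I(U
\ E, (Ω \ E) \ U), where I is the interaction (`mul_volume_le_of_isSMinimizer`). Averaging over the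
truncation height R shows that |Ω \ E| below height R doubles over steps of fixed length. Its growth
is at most polynomial, so it vanishes (`volume_eq_zero_of_truncatedCylinder_bound`). With the
normalization E is then exactly Ω ∪ S, which is connected. -/

/-! ### Convex open sets have Lipschitz boundary. -/

/-- The graph function is the upper envelope of the downward cones of slope K with vertices in U
near p. As a supremum of K-Lipschitz functions it is K-Lipschitz, and the cone condition says that
everything strictly below it near p lies in U. -/
theorem hasLipschitzBoundary_of_cone_condition {n : ℕ} {U : Set (EuclideanSpace ℝ (Fin n))}
    (hU : IsOpen U)
    (h : ∀ p ∈ frontier U, ∃ (ν : EuclideanSpace ℝ (Fin n)) (r : ℝ) (K : NNReal), ‖ν‖ = 1 ∧ 0 < r ∧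
      ∀ y ∈ U ∩ Metric.ball p r, ∀ x ∈ Metric.ball p r,
        K * ‖(x - inner ℝ ν x • ν) - (y - inner ℝ ν y • ν)‖ < inner ℝ ν y - inner ℝ ν x → x ∈ U) :
    HasLipschitzBoundary U := by
  intro p hp
  obtain ⟨ν, r, K, hν, hr, hcone⟩ := h p hp
  have hne : Nonempty ↥(U ∩ Metric.ball p r) := by
    obtain ⟨y, hy, hyU⟩ := mem_closure_iff.1 (frontier_subset_closure hp) _ Metric.isOpen_ball
      (Metric.mem_ball_self hr)
    exact ⟨⟨y, hyU, hy⟩⟩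
  have hbdd : ∀ w, BddAbove (Set.range fun y : ↥(U ∩ Metric.ball p r) =>
      inner ℝ ν y.1 - K * ‖w - (y.1 - inner ℝ ν y.1 • ν)‖) := by
    intro w
    refine ⟨‖p‖ + r, ?_⟩
    rintro _ ⟨⟨y, hyU, hy⟩, rfl⟩
    have h1 : inner ℝ ν y ≤ ‖y‖ := by simpa [hν] using real_inner_le_norm ν y
    have h2 : ‖y‖ ≤ ‖p‖ + ‖y - p‖ := norm_le_norm_add_norm_sub' y p
    rw [mem_ball_iff_norm] at hy
    have h3 : 0 ≤ K * ‖w - (y - inner ℝ ν y • ν)‖ := by positivity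
    linarith
  refine ⟨ν, r, K, fun w => ⨆ y : ↥(U ∩ Metric.ball p r),
      (inner ℝ ν y.1 - K * ‖w - (y.1 - inner ℝ ν y.1 • ν)‖), hν, hr, ?_, ?_⟩
  · refine LipschitzWith.of_le_add_mul K fun w w' => ciSup_le fun y => ?_
    have h1 := le_ciSup (hbdd w') y
    have h2 : ‖w' - (y.1 - inner ℝ ν y.1 • ν)‖ ≤ ‖w - (y.1 - inner ℝ ν y.1 • ν)‖ + dist w w' := by
      rw [dist_comm, dist_eq_norm]
      calc _ = ‖(w - (y.1 - inner ℝ ν y.1 • ν)) + (w' - w)‖ := by congr 1; abel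
        _ ≤ _ := norm_add_le _ _
    have h3 := mul_le_mul_of_nonneg_left h2 K.coe_nonneg
    rw [mul_add] at h3
    linarith
  · intro x hx
    constructor
    · intro hxU
      -- Openness leaves room to move x up along ν. The cone with vertex x + tν lies above x by t,
      -- which gives the strict inequality.
      have hcont : Filter.Tendsto (fun t : ℝ => x + t • ν) (nhdsWithin 0 (Set.Ioi 0)) (nhds x) := by
        have : Continuous fun t : ℝ => x + t • ν := by fun_prop
        simpa using (this.tendsto 0).mono_left nhdsWithin_le_nhds
      have hev := hcont.eventually ((hU.inter Metric.isOpen_ball).mem_nhds ⟨hxU, hx⟩)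
      obtain ⟨t, ht, ht0⟩ := (hev.and self_mem_nhdsWithin).exists
      refine lt_of_lt_of_le ?_ (le_ciSup (hbdd _) ⟨x + t • ν, ht⟩)
      have hin : inner ℝ ν (x + t • ν) = inner ℝ ν x + t := by
        rw [inner_add_right, inner_smul_right, real_inner_self_eq_norm_sq, hν]; ring
      dsimp only
      rw [hin]
      have : x - inner ℝ ν x • ν - (x + t • ν - (inner ℝ ν x + t) • ν) = 0 := by
        rw [add_smul]; abel
      rw [this]
      have : (0 : ℝ) < t := ht0
      simp [this]
    · intro hlt
      obtain ⟨y, hy⟩ := exists_lt_of_lt_ciSup hlt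
      exact hcone y.1 y.2 x hx (by linarith)

/-- With ν pointing from the centre a of a ball in U to the boundary point p, the convex hull of
that ball and any y in U near p contains a cone below y. -/
theorem Convex.hasLipschitzBoundary {n : ℕ} {U : Set (EuclideanSpace ℝ (Fin n))}
    (hc : Convex ℝ U) (hU : IsOpen U) : HasLipschitzBoundary U := by
  refine hasLipschitzBoundary_of_cone_condition hU fun p hp => ?_
  obtain ⟨a, ha⟩ : U.Nonempty := by
    by_contra h
    rw [Set.not_nonempty_iff_eq_empty] at h
    simp [h] at hp
  obtain ⟨δ, hδ, hball⟩ := Metric.isOpen_iff.1 hU a ha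
  have hpU : p ∉ U := by
    rw [hU.frontier_eq] at hp
    exact hp.2
  have hL : 0 < ‖p - a‖ := by
    rw [norm_pos_iff, sub_ne_zero]
    rintro rfl
    exact hpU ha
  set L := ‖p - a‖ with hLdef
  have hδL : δ ≤ L := by
    by_contra hlt
    exact hpU (hball (by rw [mem_ball_iff_norm]; linarith))
  set ν := L⁻¹ • (p - a) with hνdef
  have hν : ‖ν‖ = 1 := by
    rw [hνdef, norm_smul, norm_inv, norm_norm, ← hLdef, inv_mul_cancel₀ hL.ne']
  have hpa : p - a = L • ν := by rw [hνdef, smul_smul, mul_inv_cancel₀ hL.ne', one_smul]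
  -- Half of the radius δ absorbs the displacement y - p, the other half the opening of the cone;
  -- hence the slope L / (δ / 2).
  refine ⟨ν, δ / 2, ⟨2 * L / δ, by positivity⟩, hν, by positivity, ?_⟩
  rintro y ⟨hyU, hy⟩ x hx hcone
  rw [mem_ball_iff_norm] at hy hx
  set d := y - x with hd
  have hin : inner ℝ ν d = inner ℝ ν y - inner ℝ ν x := by rw [hd, inner_sub_right]
  rw [← hin] at hcone
  set c : ℝ := inner ℝ ν d with hcdef
  have hP : ‖(x - inner ℝ ν x • ν) - (y - inner ℝ ν y • ν)‖ = ‖d - c • ν‖ := by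
    rw [← norm_neg, hin, sub_smul, hd]; congr 1; abel
  rw [hP] at hcone
  change 2 * L / δ * ‖d - c • ν‖ < c at hcone
  have hc0 : 0 < c := lt_of_le_of_lt (by positivity) hcone
  have hcle : c ≤ ‖d‖ := by simpa [hν] using real_inner_le_norm ν d
  have hdle : ‖d‖ < δ := by
    calc ‖d‖ = ‖(y - p) - (x - p)‖ := by rw [hd]; congr 1; abel
      _ ≤ ‖y - p‖ + ‖x - p‖ := norm_sub_le _ _
      _ < δ := by linarith
  have hτ1 : c / L ≤ 1 := by rw [div_le_one hL]; linarith
  have hτ0 : 0 < c / L := by positivity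
  -- Prolong the segment from y through x until it has dropped by L in the direction ν. It then ends
  -- in the ball around a.
  set a' := y - (L / c) • d with ha'
  have ha'U : a' ∈ U := by
    apply hball
    rw [mem_ball_iff_norm]
    have e1 : a' - a = (y - p) - (L / c) • (d - c • ν) := by
      have : (L / c) • (d - c • ν) = (L / c) • d - (p - a) := by
        rw [hpa, smul_sub, smul_smul, div_mul_cancel₀ _ hc0.ne']
      rw [this, ha']; abel
    rw [e1]
    have e2 : ‖(L / c) • (d - c • ν)‖ < δ / 2 := by
      rw [norm_smul, Real.norm_of_nonneg (by positivity)]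
      rw [div_mul_eq_mul_div, div_lt_iff₀ hδ] at hcone
      rw [div_mul_eq_mul_div, div_lt_iff₀ hc0]
      linarith
    linarith [norm_sub_le (y - p) ((L / c) • (d - c • ν))]
  have hx' : x = (1 - c / L) • y + (c / L) • a' := by
    have e3 : (c / L) • (L / c) • d = d := by
      rw [smul_smul, div_mul_div_cancel₀ hL.ne', div_self hc0.ne', one_smul]
    rw [ha', smul_sub (c / L), e3, sub_smul, one_smul, hd]; abel
  rw [hx']
  exact hc hyU ha'U (by linarith) hτ0.le (by ring)

/-! ### The kernel and its integrability. -/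

noncomputable section

/-- The kernel `|z|^{-(n+s)}` of the fractional perimeter. -/
def fracKernel {n : ℕ} (s : ℝ) (z : EuclideanSpace ℝ (Fin n)) : ENNReal :=
  ENNReal.ofReal (1 / ‖z‖ ^ ((n : ℝ) + s))

end

section Kernel

variable {n : ℕ} {s : ℝ}

@[fun_prop]
theorem measurable_fracKernel : Measurable (fracKernel (n := n) s) := by
  unfold fracKernel; fun_prop

theorem fracKernel_neg (z : EuclideanSpace ℝ (Fin n)) : fracKernel s (-z) = fracKernel s z := by
  simp [fracKernel]

theorem fracKernel_sub_comm (x y : EuclideanSpace ℝ (Fin n)) :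
    fracKernel s (x - y) = fracKernel s (y - x) := by
  rw [← neg_sub, fracKernel_neg]

theorem interaction_eq (A B : Set (EuclideanSpace ℝ (Fin n))) :
    interaction s A B = ∫⁻ x in A, ∫⁻ y in B, fracKernel s (x - y) := rfl

/-- In polar coordinates the integrand is r^{-s} near 0 and r^{-1-s} at infinity, so the two bounds
on s are exactly what is needed. -/
theorem lintegral_min_one_norm_mul_fracKernel_lt_top (hn : 1 ≤ n) (hs0 : 0 < s) (hs1 : s < 1) :
    ∫⁻ z : EuclideanSpace ℝ (Fin n), ENNReal.ofReal (min 1 ‖z‖) * fracKernel s z < ⊤ := by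
  have : Nonempty (Fin n) := ⟨⟨0, hn⟩⟩
  have hint : Integrable (fun z : EuclideanSpace ℝ (Fin n) =>
      (fun r : ℝ => min 1 r * (1 / r ^ ((n : ℝ) + s))) ‖z‖) volume := by
    rw [integrable_fun_norm_addHaar volume (f := fun r : ℝ => min 1 r * (1 / r ^ ((n : ℝ) + s)))]
    rw [finrank_euclideanSpace_fin, ← Set.Ioc_union_Ioi_eq_Ioi (zero_le_one (α := ℝ))]
    have hrw : ∀ r : ℝ, 0 < r → r ^ (n - 1) • (1 / r ^ ((n : ℝ) + s)) = r ^ (-1 - s) := by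
      intro r hr
      rw [smul_eq_mul, one_div, ← Real.rpow_neg hr.le, ← Real.rpow_natCast, ← Real.rpow_add hr]
      congr 1
      push_cast [Nat.cast_sub hn]
      ring
    refine IntegrableOn.union ?_ ?_
    · have h1 : IntegrableOn (fun r : ℝ => r ^ (-s)) (Set.Ioc 0 1) :=
        (intervalIntegral.intervalIntegrable_rpow' (by linarith)).1
      refine h1.congr_fun (fun r hr => ?_) measurableSet_Ioc
      have h2 := hrw r hr.1
      simp only [smul_eq_mul] at h2 ⊢
      rw [min_eq_right hr.2, mul_left_comm, h2]
      nth_rw 2 [← Real.rpow_one r]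
      rw [← Real.rpow_add hr.1]
      congr 1; ring
    · have h1 : IntegrableOn (fun r : ℝ => r ^ (-1 - s)) (Set.Ioi 1) :=
        integrableOn_Ioi_rpow_of_lt (by linarith) one_pos
      refine h1.congr_fun (fun r hr => ?_) measurableSet_Ioi
      have hr' : (1 : ℝ) < r := hr
      have h2 := hrw r (by linarith)
      simp only [smul_eq_mul] at h2 ⊢
      rw [min_eq_left hr'.le, one_mul, h2]
  have := hint.lintegral_lt_top
  refine lt_of_eq_of_lt (lintegral_congr fun z => ?_) this
  rw [fracKernel, ← ENNReal.ofReal_mul (by positivity)]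

/-- Dominated convergence as l → ∞. This integral is the averaged cost of cutting the cylinder at a
height chosen from an interval of length l. -/
theorem exists_lintegral_min_one_div_mul_fracKernel_le (hn : 1 ≤ n) (hs0 : 0 < s) (hs1 : s < 1)
    {η : ENNReal} (hη : 0 < η) : ∃ l : ℕ, 1 ≤ l ∧
      ∫⁻ z : EuclideanSpace ℝ (Fin n), ENNReal.ofReal (min 1 (‖z‖ / l)) * fracKernel s z ≤ η := by
  have hlim : Filter.Tendsto (fun l : ℕ => ∫⁻ z : EuclideanSpace ℝ (Fin n),
      ENNReal.ofReal (min 1 (‖z‖ / l)) * fracKernel s z) Filter.atTop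
      (nhds (∫⁻ _ : EuclideanSpace ℝ (Fin n), 0)) := by
    refine tendsto_lintegral_of_dominated_convergence'
      (fun z => ENNReal.ofReal (min 1 ‖z‖) * fracKernel s z) (fun l => by fun_prop)
      ?_ (lintegral_min_one_norm_mul_fracKernel_lt_top hn hs0 hs1).ne ?_
    · intro l
      filter_upwards with z
      gcongr
      rcases Nat.eq_zero_or_pos l with rfl | hl
      · simp
      · exact div_le_self (norm_nonneg _) (by exact_mod_cast hl)
    · filter_upwards with z
      have h1 : Filter.Tendsto (fun l : ℕ => ‖z‖ / (l : ℝ)) Filter.atTop (nhds 0) :=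
        tendsto_const_div_atTop_nhds_zero_nat _
      have h2 : Filter.Tendsto (fun l : ℕ => ENNReal.ofReal (min 1 (‖z‖ / l))) Filter.atTop
          (nhds 0) := by
        have := ENNReal.tendsto_ofReal ((tendsto_const_nhds (x := (1 : ℝ))).min h1)
        simpa using this
      have h3 := ENNReal.Tendsto.mul_const (b := fracKernel s z) h2
        (Or.inr ENNReal.ofReal_ne_top)
      simpa using h3
  rw [lintegral_zero] at hlim
  obtain ⟨l, hl1, hl2⟩ := ((Filter.eventually_ge_atTop 1).and (hlim.eventually_le_const hη)).exists
  exact ⟨l, hl1, hl2⟩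

end Kernel

/-! ### Inversion in a sphere. -/

section Inversion

open EuclideanGeometry

theorem abs_det_reflection {F : Type*} [NormedAddCommGroup F] [InnerProductSpace ℝ F]
    [FiniteDimensional ℝ F] (K : Submodule ℝ F) (c : ℝ) :
    |(c • (K.reflection : F →L[ℝ] F)).det| = |c| ^ Module.finrank ℝ F := by
  have h : (c • (K.reflection : F →L[ℝ] F)).det = c ^ Module.finrank ℝ F *
      LinearMap.det K.reflection.toLinearMap := by
    rw [ContinuousLinearMap.det, ContinuousLinearMap.toLinearMap_smul, LinearMap.det_smul]
    rfl
  rw [h, Submodule.det_reflection]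
  simp [abs_mul, abs_pow]

/-- Inversion in the sphere through `x` centred at the origin compares the exterior with the
interior of the ball. -/
theorem lintegral_exterior_inversion_le {m : ℕ} (x : EuclideanSpace ℝ (Fin m))
    (hx : 0 < ‖x‖) (f : ℝ → ENNReal) (hf : ∀ a b, 0 < a → a ≤ b → f b ≤ f a) :
    ∫⁻ y in {y : EuclideanSpace ℝ (Fin m) | ‖x‖ < ‖y‖},
        ENNReal.ofReal ((‖x‖ / ‖y‖) ^ (2 * m)) * f ‖x - y‖ ≤
      ∫⁻ y in {y : EuclideanSpace ℝ (Fin m) | ‖y‖ < ‖x‖}, f ‖x - y‖ := by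
  set S := {y : EuclideanSpace ℝ (Fin m) | ‖x‖ < ‖y‖} with hS
  have hSm : MeasurableSet S := measurableSet_lt measurable_const measurable_norm
  have hne : ∀ y ∈ S, y ≠ 0 := fun y hy => norm_pos_iff.1 (hx.trans hy)
  have himg : inversion 0 ‖x‖ '' S ⊆ {y : EuclideanSpace ℝ (Fin m) | ‖y‖ < ‖x‖} := by
    rintro _ ⟨y, hy, rfl⟩
    have hy' : ‖x‖ < ‖y‖ := hy
    have h := dist_inversion_center (0 : EuclideanSpace ℝ (Fin m)) y ‖x‖
    rw [dist_zero_right, dist_zero_right] at h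
    change ‖_‖ < ‖x‖
    rw [h, div_lt_iff₀ (hx.trans hy'), sq]
    exact mul_lt_mul_of_pos_left hy' hx
  have hinj : Set.InjOn (inversion (0 : EuclideanSpace ℝ (Fin m)) ‖x‖) S :=
    (inversion_injective _ hx.ne').injOn
  refine le_trans ?_ (lintegral_mono_set himg)
  rw [lintegral_image_eq_lintegral_abs_det_fderiv_mul volume hSm
    (fun y hy => (hasFDerivAt_inversion (hne y hy)).hasFDerivWithinAt) hinj]
  refine setLIntegral_mono' hSm fun y hy => ?_
  have hy' : ‖x‖ < ‖y‖ := hy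
  -- The derivative of the inversion is (‖x‖/‖y‖)² times a reflection, whence the Jacobian with
  -- exponent 2m.
  rw [abs_det_reflection, finrank_euclideanSpace_fin, dist_zero_right, abs_of_nonneg (by positivity),
    ← pow_mul]
  refine mul_le_mul_right (hf _ _ ?_ ?_) _
  -- Monotonicity of f is available only at positive distances: the kernel has value 0 at the
  -- origin, because 1 / 0 = 0. So the inverted point must differ from x.
  · rw [norm_pos_iff, sub_ne_zero]
    intro h
    have h1 : ‖inversion (0 : EuclideanSpace ℝ (Fin m)) ‖x‖ y‖ < ‖x‖ := himg ⟨y, hy, rfl⟩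
    rw [← h] at h1
    exact lt_irrefl _ h1
  -- Since x is fixed, inverting y multiplies its distance to x by ‖x‖/‖y‖ < 1.
  · have hfix : inversion (0 : EuclideanSpace ℝ (Fin m)) ‖x‖ x = x :=
      inversion_of_mem_sphere (by simp)
    have h := dist_inversion_inversion (norm_pos_iff.1 hx) (hne y hy) ‖x‖
    rw [hfix, dist_eq_norm, dist_zero_right, dist_zero_right, dist_eq_norm] at h
    rw [h]
    refine mul_le_of_le_one_left (norm_nonneg _) ?_
    rw [div_le_one (mul_pos hx (hx.trans hy')), sq]
    exact (mul_lt_mul_of_pos_left hy' hx).le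

end Inversion

/-! ### Bounded convex open sets have finite fractional perimeter. -/

section ConvexPerimeter

variable {n : ℕ} {s : ℝ}

theorem lintegral_fracKernel_sub (x : EuclideanSpace ℝ (Fin n)) {B : Set (EuclideanSpace ℝ (Fin n))}
    (hB : MeasurableSet B) :
    ∫⁻ y in B, fracKernel s (x - y) = ∫⁻ z, B.indicator 1 (x + z) * fracKernel s z := by
  rw [← lintegral_indicator hB, ← lintegral_add_left_eq_self _ x]
  refine lintegral_congr fun z => ?_
  by_cases h : x + z ∈ B
  · simp [h, fracKernel_neg]
  · simp [h]

theorem interaction_eq_lintegral_volume {A B : Set (EuclideanSpace ℝ (Fin n))}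
    (hB : MeasurableSet B) :
    interaction s A B = ∫⁻ z, volume {x | x ∈ A ∧ x + z ∈ B} * fracKernel s z := by
  have hmeas : Measurable fun q : EuclideanSpace ℝ (Fin n) × EuclideanSpace ℝ (Fin n) =>
      B.indicator (1 : EuclideanSpace ℝ (Fin n) → ENNReal) (q.1 + q.2) :=
    (measurable_one.indicator hB).comp (measurable_fst.add measurable_snd)
  rw [interaction_eq]
  simp_rw [lintegral_fracKernel_sub _ hB]
  rw [lintegral_lintegral_swap (hmeas.mul (by fun_prop)).aemeasurable]
  refine lintegral_congr fun z => ?_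
  rw [lintegral_mul_const _ (f := fun x => B.indicator (1 : EuclideanSpace ℝ (Fin n) → ENNReal) (x + z))
    (hmeas.comp (measurable_id.prodMk measurable_const))]
  congr 1
  have hmB : MeasurableSet {x | x + z ∈ B} := (measurable_add_const z) hB
  have : (fun x => B.indicator (1 : EuclideanSpace ℝ (Fin n) → ENNReal) (x + z)) =
      {x | x + z ∈ B}.indicator 1 := by
    ext x; simp [Set.indicator]
  rw [this, lintegral_indicator_one hmB, Measure.restrict_apply hmB]
  congr 1
  ext x; simp [and_comm]

/-- The homothety with centre a and ratio 1 - t, t = 2‖z‖/δ, sends U to a subset whose translate by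
z is still in U, because the ball around a absorbs the shift. By Bernoulli the lost volume is at
most nt|U|. For large ‖z‖ the bound |U| suffices, which explains the summand 1 in the constant. -/
theorem Convex.volume_translate_diff_le {U : Set (EuclideanSpace ℝ (Fin n))} (hn : 1 ≤ n)
    (hc : Convex ℝ U) (hU : IsOpen U) (hb : Bornology.IsBounded U)
    {a : EuclideanSpace ℝ (Fin n)} {δ : ℝ} (hδ : 0 < δ) (hball : Metric.ball a δ ⊆ U)
    (z : EuclideanSpace ℝ (Fin n)) :
    volume {x | x ∈ U ∧ x + z ∈ Uᶜ} ≤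
      volume U * ENNReal.ofReal ((1 + 2 * n / δ) * min 1 ‖z‖) := by
  have hn' : (1 : ℝ) ≤ n := by exact_mod_cast hn
  have htriv : 1 ≤ (1 + 2 * n / δ) * min 1 ‖z‖ → volume {x | x ∈ U ∧ x + z ∈ Uᶜ} ≤
      volume U * ENNReal.ofReal ((1 + 2 * n / δ) * min 1 ‖z‖) := by
    intro h
    refine (measure_mono fun x hx => hx.1).trans ?_
    exact le_mul_of_one_le_right zero_le (by simpa using h)
  have hD : 0 ≤ 2 * n / δ := by positivity
  rcases le_or_gt 1 ‖z‖ with h1 | h1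
  · exact htriv (by rw [min_eq_left h1]; linarith)
  rw [min_eq_right h1.le] at htriv ⊢
  rcases le_or_gt δ (2 * ‖z‖) with h2 | h2
  · apply htriv
    have : 1 ≤ 2 * n / δ * ‖z‖ := by
      rw [div_mul_eq_mul_div, one_le_div hδ]
      nlinarith [norm_nonneg z]
    nlinarith [norm_nonneg z]
  rcases eq_or_ne z 0 with rfl | hz
  · have : {x | x ∈ U ∧ x + 0 ∈ Uᶜ} = ∅ := by ext x; simp
    rw [this]; simp
  have hzpos : 0 < ‖z‖ := norm_pos_iff.2 hz
  set t : ℝ := 2 * ‖z‖ / δ with ht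
  have ht0 : 0 < t := by positivity
  have ht1 : t < 1 := by rw [ht, div_lt_one hδ]; exact h2
  have haU : a ∈ U := hball (Metric.mem_ball_self hδ)
  set H := AffineMap.homothety a (1 - t) '' U with hH
  have hHU : H ⊆ U := by
    rintro _ ⟨u, hu, rfl⟩
    rw [AffineMap.homothety_apply, vsub_eq_sub, vadd_eq_add]
    have : (1 - t) • (u - a) + a = (1 - t) • u + t • a := by
      rw [smul_sub, sub_smul, sub_smul, one_smul, one_smul]; abel
    rw [this]
    exact hc hu haU (by linarith) ht0.le (by ring)
  have hHz : ∀ y ∈ H, y + z ∈ U := by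
    rintro _ ⟨u, hu, rfl⟩
    rw [AffineMap.homothety_apply, vsub_eq_sub, vadd_eq_add]
    have : (1 - t) • (u - a) + a + z = (1 - t) • u + t • (a + t⁻¹ • z) := by
      rw [smul_add, smul_smul, mul_inv_cancel₀ ht0.ne', smul_sub, sub_smul, sub_smul, one_smul,
        one_smul, one_smul]; abel
    rw [this]
    refine hc hu (hball ?_) (by linarith) ht0.le (by ring)
    rw [mem_ball_iff_norm, add_sub_cancel_left, norm_smul, norm_inv, Real.norm_of_nonneg ht0.le, ht]
    have : (2 * ‖z‖ / δ)⁻¹ * ‖z‖ = δ / 2 := by field_simp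
    linarith
  have hHvol : volume H = ENNReal.ofReal ((1 - t) ^ n) * volume U := by
    rw [hH, Measure.addHaar_image_homothety, finrank_euclideanSpace_fin,
      abs_of_nonneg (pow_nonneg (by linarith) n)]
  have hUfin : volume U ≠ ⊤ := hb.measure_lt_top.ne
  have hHm : MeasurableSet H := by
    have := (AffineMap.homothety_isOpenMap a (1 - t) (by linarith)) U hU
    exact this.measurableSet
  have hsub : {x | x ∈ U ∧ x + z ∈ Uᶜ} ⊆ U \ H := fun x hx => ⟨hx.1, fun hxH => hx.2 (hHz x hxH)⟩
  refine (measure_mono hsub).trans ?_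
  rw [measure_sdiff hHU hHm.nullMeasurableSet ((measure_mono hHU).trans_lt hUfin.lt_top).ne, hHvol,
    tsub_le_iff_right, mul_comm (ENNReal.ofReal _) (volume U), ← mul_add,
    ← ENNReal.ofReal_add (by positivity) (pow_nonneg (by linarith) n)]
  refine le_mul_of_one_le_right zero_le ?_
  rw [ENNReal.one_le_ofReal]
  have hbern := one_add_mul_le_pow (a := -t) (by linarith) n
  have e1 : 2 * n / δ * ‖z‖ = n * t := by rw [ht]; ring
  have e2 : 1 + -t = 1 - t := by ring
  rw [e2] at hbern
  nlinarith

/-- This finiteness is what allows common terms to be cancelled when perimeters in [0, ∞] are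
compared. -/
theorem Convex.interaction_compl_lt_top {U : Set (EuclideanSpace ℝ (Fin n))} (hn : 1 ≤ n)
    (hs0 : 0 < s) (hs1 : s < 1) (hc : Convex ℝ U) (hU : IsOpen U) (hb : Bornology.IsBounded U) :
    interaction s U Uᶜ < ⊤ := by
  rcases U.eq_empty_or_nonempty with rfl | ⟨a, ha⟩
  · simp [interaction]
  obtain ⟨δ, hδ, hball⟩ := Metric.isOpen_iff.1 hU a ha
  rw [interaction_eq_lintegral_volume hU.measurableSet.compl]
  calc ∫⁻ z, volume {x | x ∈ U ∧ x + z ∈ Uᶜ} * fracKernel s z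
      ≤ ∫⁻ z, volume U * ENNReal.ofReal (1 + 2 * n / δ) *
          (ENNReal.ofReal (min 1 ‖z‖) * fracKernel s z) := by
        refine lintegral_mono fun z => ?_
        have h := hc.volume_translate_diff_le hn hU hb hδ hball z
        rw [ENNReal.ofReal_mul (by positivity)] at h
        rw [← mul_assoc, mul_assoc (volume U)]
        gcongr
    _ = volume U * ENNReal.ofReal (1 + 2 * n / δ) *
          ∫⁻ z : EuclideanSpace ℝ (Fin n), ENNReal.ofReal (min 1 ‖z‖) * fracKernel s z := by
        rw [lintegral_const_mul _ (by fun_prop)]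
    _ < ⊤ := by
        refine ENNReal.mul_lt_top (ENNReal.mul_lt_top hb.measure_lt_top ENNReal.ofReal_lt_top) ?_
        exact lintegral_min_one_norm_mul_fracKernel_lt_top hn hs0 hs1

end ConvexPerimeter

/-! ### Splitting into horizontal and vertical coordinates. -/

section Coordinates

variable {m : ℕ}

theorem norm_sq_eq_horizontalPart (x : EuclideanSpace ℝ (Fin (m + 1))) :
    ‖x‖ ^ 2 = ‖horizontalPart x‖ ^ 2 + x (Fin.last m) ^ 2 := by
  rw [EuclideanSpace.real_norm_sq_eq, EuclideanSpace.real_norm_sq_eq, Fin.sum_univ_castSucc]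
  rfl

theorem norm_eq_sqrt_horizontalPart (x : EuclideanSpace ℝ (Fin (m + 1))) :
    ‖x‖ = √(‖horizontalPart x‖ ^ 2 + x (Fin.last m) ^ 2) := by
  rw [← norm_sq_eq_horizontalPart, Real.sqrt_sq (norm_nonneg _)]

theorem norm_horizontalPart_le (x : EuclideanSpace ℝ (Fin (m + 1))) :
    ‖horizontalPart x‖ ≤ ‖x‖ := by
  have := norm_sq_eq_horizontalPart x
  exact abs_le_of_sq_le_sq' (by nlinarith [sq_nonneg (x (Fin.last m))]) (norm_nonneg _) |>.2

theorem abs_last_le (x : EuclideanSpace ℝ (Fin (m + 1))) : |x (Fin.last m)| ≤ ‖x‖ := by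
  simpa using PiLp.norm_apply_le x (Fin.last m)

theorem horizontalPart_add (x y : EuclideanSpace ℝ (Fin (m + 1))) :
    horizontalPart (x + y) = horizontalPart x + horizontalPart y := rfl

theorem horizontalPart_sub (x y : EuclideanSpace ℝ (Fin (m + 1))) :
    horizontalPart (x - y) = horizontalPart x - horizontalPart y := rfl

theorem horizontalPart_smul (c : ℝ) (x : EuclideanSpace ℝ (Fin (m + 1))) :
    horizontalPart (c • x) = c • horizontalPart x := rfl

@[fun_prop]
theorem continuous_horizontalPart : Continuous (horizontalPart (m := m)) := by
  unfold horizontalPart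
  fun_prop

@[fun_prop]
theorem measurable_horizontalPart : Measurable (horizontalPart (m := m)) :=
  continuous_horizontalPart.measurable

theorem measurePreserving_horizontalPart_prodMk_last :
    MeasurePreserving (fun x : EuclideanSpace ℝ (Fin (m + 1)) =>
      (horizontalPart x, x (Fin.last m))) volume (volume.prod volume) := by
  have h1 := PiLp.volume_preserving_ofLp (Fin (m + 1))
  have h2 := volume_preserving_piFinSuccAbove (fun _ : Fin (m + 1) => ℝ) (Fin.last m)
  have h3 := Measure.measurePreserving_swap (μ := (volume : Measure ℝ))
    (ν := (volume : Measure (Fin m → ℝ)))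
  have h4 := (PiLp.volume_preserving_toLp (Fin m)).prod (MeasurePreserving.id (volume : Measure ℝ))
  have h := h4.comp (h3.comp (h2.comp h1))
  have e : (fun x : EuclideanSpace ℝ (Fin (m + 1)) => (horizontalPart x, x (Fin.last m))) =
      Prod.map (WithLp.toLp 2) id ∘ Prod.swap ∘
        MeasurableEquiv.piFinSuccAbove (fun _ => ℝ) (Fin.last m) ∘ WithLp.ofLp := by
    funext x
    refine Prod.ext ?_ rfl
    ext i
    simp [horizontalPart, MeasurableEquiv.piFinSuccAbove, Fin.init]
  rw [e]
  exact h

/-- Fubini reduces the claim to the inversion estimate in the horizontal variable at each height b,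
since f(√(d² + (c - b)²)) is again nonincreasing in d. -/
theorem lintegral_slab_exterior_inversion_le (x : EuclideanSpace ℝ (Fin (m + 1)))
    (hx : 0 < ‖horizontalPart x‖) {f : ℝ → ENNReal} (hfm : Measurable f)
    (hf : ∀ a b, 0 < a → a ≤ b → f b ≤ f a) {T : Set ℝ} (hT : MeasurableSet T) :
    ∫⁻ y in {y : EuclideanSpace ℝ (Fin (m + 1)) | y (Fin.last m) ∈ T ∧
        ‖horizontalPart x‖ < ‖horizontalPart y‖},
        ENNReal.ofReal ((‖horizontalPart x‖ / ‖horizontalPart y‖) ^ (2 * m)) * f ‖x - y‖ ≤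
      ∫⁻ y in {y : EuclideanSpace ℝ (Fin (m + 1)) | y (Fin.last m) ∈ T ∧
        ‖horizontalPart y‖ < ‖horizontalPart x‖}, f ‖x - y‖ := by
  set x' := horizontalPart x
  set c := x (Fin.last m)
  have hnorm : ∀ y : EuclideanSpace ℝ (Fin (m + 1)),
      ‖x - y‖ = √(‖x' - horizontalPart y‖ ^ 2 + (c - y (Fin.last m)) ^ 2) := fun y => by
    rw [norm_eq_sqrt_horizontalPart, horizontalPart_sub]; rfl
  have key : ∀ (g : EuclideanSpace ℝ (Fin m) → ENNReal) (A : Set (EuclideanSpace ℝ (Fin m))),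
      Measurable g → MeasurableSet A →
      ∫⁻ y in {y : EuclideanSpace ℝ (Fin (m + 1)) | y (Fin.last m) ∈ T ∧ horizontalPart y ∈ A},
        g (horizontalPart y) * f ‖x - y‖ =
      ∫⁻ b in T, ∫⁻ u in A, g u * f √(‖x' - u‖ ^ 2 + (c - b) ^ 2) := by
    intro g A hg hA
    have hF : Measurable fun q : EuclideanSpace ℝ (Fin m) × ℝ =>
        g q.1 * f √(‖x' - q.1‖ ^ 2 + (c - q.2) ^ 2) := by fun_prop
    rw [← lintegral_prod_symm' (fun q : EuclideanSpace ℝ (Fin m) × ℝ =>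
        g q.1 * f √(‖x' - q.1‖ ^ 2 + (c - q.2) ^ 2)) hF, Measure.prod_restrict,
      ← measurePreserving_horizontalPart_prodMk_last.setLIntegral_comp_preimage (hA.prod hT) hF]
    have hset : (fun x : EuclideanSpace ℝ (Fin (m + 1)) => (horizontalPart x, x (Fin.last m))) ⁻¹'
        A ×ˢ T = {y | y (Fin.last m) ∈ T ∧ horizontalPart y ∈ A} := by
      ext y; simp [and_comm]
    rw [hset]
    simp_rw [hnorm]
  have h1 := key (fun u => ENNReal.ofReal ((‖x'‖ / ‖u‖) ^ (2 * m))) {u | ‖x'‖ < ‖u‖} (by fun_prop)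
    (measurableSet_lt measurable_const measurable_norm)
  have h2 := key (fun _ => 1) {u | ‖u‖ < ‖x'‖} (by fun_prop)
    (measurableSet_lt measurable_norm measurable_const)
  simp only [one_mul, Set.mem_ofPred_eq] at h1 h2
  rw [h1, h2]
  refine lintegral_mono fun b => ?_
  refine lintegral_exterior_inversion_le x' hx (fun d => f √(d ^ 2 + (c - b) ^ 2)) fun p q hp hpq => ?_
  refine hf _ _ (Real.sqrt_pos.2 (by positivity)) (Real.sqrt_le_sqrt ?_)
  gcongr

end Coordinates

/-! ### Truncated kernels, which make the integrals over G × G finite. -/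

noncomputable section

/-- The fractional kernel truncated from above at height `N`. -/
def truncKernel {n : ℕ} (N : ℕ) (s : ℝ) (z : EuclideanSpace ℝ (Fin n)) : ENNReal :=
  min (fracKernel s z) N

end

section Truncation

variable {n N : ℕ} {s : ℝ}

@[fun_prop]
theorem measurable_truncKernel : Measurable (truncKernel (n := n) N s) := by
  unfold truncKernel; fun_prop

theorem truncKernel_sub_comm (x y : EuclideanSpace ℝ (Fin n)) :
    truncKernel N s (x - y) = truncKernel N s (y - x) := by
  rw [truncKernel, fracKernel_sub_comm]; rfl

theorem truncKernel_le (z : EuclideanSpace ℝ (Fin n)) : truncKernel N s z ≤ fracKernel s z :=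
  min_le_left _ _

theorem truncKernel_le_natCast (z : EuclideanSpace ℝ (Fin n)) : truncKernel N s z ≤ N :=
  min_le_right _ _

theorem truncKernel_mono (z : EuclideanSpace ℝ (Fin n)) : Monotone fun N => truncKernel N s z := by
  intro a b hab
  have : (a : ENNReal) ≤ b := by exact_mod_cast hab
  exact min_le_min_left _ this

theorem iSup_truncKernel (z : EuclideanSpace ℝ (Fin n)) :
    ⨆ N, truncKernel N s z = fracKernel s z := by
  refine le_antisymm (iSup_le fun N => truncKernel_le z) ?_
  obtain ⟨N, hN⟩ := ENNReal.exists_nat_gt (r := fracKernel s z) ENNReal.ofReal_ne_top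
  exact le_iSup_of_le N (le_min le_rfl hN.le)

theorem truncKernel_pos (hN : 1 ≤ N) {z : EuclideanSpace ℝ (Fin n)} (hz : z ≠ 0) :
    0 < truncKernel N s z := by
  have : 0 < ‖z‖ := norm_pos_iff.2 hz
  refine lt_min (ENNReal.ofReal_pos.2 (by positivity)) ?_
  exact_mod_cast hN

theorem setLIntegral_truncKernel_pos (hN : 1 ≤ N) {W : Set (EuclideanSpace ℝ (Fin n))}
    (hW : IsOpen W) (hne : W.Nonempty) (h0 : 0 ∉ W) : 0 < ∫⁻ z in W, truncKernel N s z := by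
  rw [setLIntegral_pos_iff measurable_truncKernel]
  have : W ⊆ Function.support (truncKernel N s) ∩ W := fun z hz =>
    ⟨(truncKernel_pos hN (by rintro rfl; exact h0 hz)).ne', hz⟩
  exact (hW.measure_pos volume hne).trans_le (measure_mono this)

theorem setLIntegral_truncKernel_le_of_translate (x : EuclideanSpace ℝ (Fin n))
    {W₀ W : Set (EuclideanSpace ℝ (Fin n))} (hW : MeasurableSet W) (h : ∀ z ∈ W₀, x + z ∈ W) :
    ∫⁻ z in W₀, truncKernel N s z ≤ ∫⁻ y in W, truncKernel N s (x - y) := by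
  rw [← (measurePreserving_add_left volume x).setLIntegral_comp_preimage hW (by fun_prop)]
  refine (lintegral_mono_set h).trans (le_of_eq (lintegral_congr fun z => ?_))
  rw [truncKernel_sub_comm, add_sub_cancel_left]

theorem iSup_setLIntegral_truncKernel {W : Set (EuclideanSpace ℝ (Fin n))} :
    ⨆ N, ∫⁻ z in W, truncKernel N s z = ∫⁻ z in W, fracKernel s z := by
  rw [← lintegral_iSup (fun N => measurable_truncKernel) (fun a b hab z => truncKernel_mono z hab)]
  simp_rw [iSup_truncKernel]

end Truncation

/-! ### The half-space integral blows up as M tends to 0. -/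

section Blowup

variable {m : ℕ} {s : ℝ}

/-- The ball of radius M/2 centred at height 5M/2 lies in the half-space and within distance 3M of
the origin. Its volume scales as M^{m+1}, the kernel on it as M^{-(m+1+s)}. -/
theorem le_setLIntegral_halfSpace_fracKernel {M : ℝ} (hs0 : 0 < s) (hM : 0 < M) :
    ENNReal.ofReal (M ^ (-s) * (1 / 3 ^ ((m : ℝ) + 1 + s) * (1 / 2) ^ (m + 1))) *
      volume (Metric.ball (0 : EuclideanSpace ℝ (Fin (m + 1))) 1) ≤
    ∫⁻ z in {z : EuclideanSpace ℝ (Fin (m + 1)) | 2 * M < z (Fin.last m)}, fracKernel s z := by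
  set c : EuclideanSpace ℝ (Fin (m + 1)) := EuclideanSpace.single (Fin.last m) (5 * M / 2) with hc
  have hcn : ‖c‖ = 5 * M / 2 := by 
    rw [hc, PiLp.norm_single, Real.norm_of_nonneg (by positivity)]
  have hsub : Metric.ball c (M / 2) ⊆
      {z : EuclideanSpace ℝ (Fin (m + 1)) | 2 * M < z (Fin.last m)} := by
    intro z hz
    rw [mem_ball_iff_norm] at hz
    have h1 := (abs_last_le (z - c)).trans_lt hz
    have h2 : (z - c) (Fin.last m) = z (Fin.last m) - 5 * M / 2 := by simp [hc]
    rw [h2, abs_lt] at h1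
    change 2 * M < z (Fin.last m)
    linarith
  refine le_trans ?_ (lintegral_mono_set hsub)
  have hk : ∀ z ∈ Metric.ball c (M / 2),
      ENNReal.ofReal (1 / (3 * M) ^ ((m : ℝ) + 1 + s)) ≤ fracKernel s z := by
    intro z hz
    have hz0 : 2 * M < z (Fin.last m) := hsub hz
    rw [mem_ball_iff_norm] at hz
    have h1 : ‖z‖ ≤ 3 * M := by linarith [norm_le_norm_add_norm_sub' z c]
    have h2 : 0 < ‖z‖ := by linarith [abs_last_le z, le_abs_self (z (Fin.last m))]
    refine ENNReal.ofReal_le_ofReal ?_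
    push_cast
    gcongr
  refine le_trans ?_ (setLIntegral_mono' measurableSet_ball hk)
  rw [setLIntegral_const, Measure.addHaar_ball volume c (by positivity), finrank_euclideanSpace_fin,
    ← mul_assoc (ENNReal.ofReal (1 / _)), ← ENNReal.ofReal_mul (by positivity)]
  gcongr ENNReal.ofReal ?_ * _
  refine le_of_eq ?_
  rw [Real.mul_rpow (by norm_num) hM.le]
  have h1 : M ^ ((m : ℝ) + 1 + s) = M ^ (m + 1) * M ^ s := by
    rw [Real.rpow_add hM]
    congr 1
    exact_mod_cast Real.rpow_natCast M (m + 1)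
  rw [h1, Real.rpow_neg hM.le]
  have : 0 < M ^ s := Real.rpow_pos_of_pos hM s
  have : 0 < (3 : ℝ) ^ ((m : ℝ) + 1 + s) := by positivity
  rw [div_pow, div_pow, one_pow]
  field_simp

/-- The threshold M₀ comes from the blow-up of the full kernel. The truncation level N₀ depends on M
and comes from monotone convergence. -/
theorem exists_forall_lt_setLIntegral_halfSpace_truncKernel (hs0 : 0 < s) {C : ENNReal}
    (hC : C < ⊤) : ∃ M₀ : ℝ, 0 < M₀ ∧ M₀ < 1 ∧ ∀ M, 0 < M → M < M₀ → ∃ N₀ : ℕ, ∀ N, N₀ ≤ N →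
      C ≤ ∫⁻ z in {z : EuclideanSpace ℝ (Fin (m + 1)) | 2 * M < z (Fin.last m)},
        truncKernel N s z := by
  set b : ℝ := 1 / 3 ^ ((m : ℝ) + 1 + s) * (1 / 2) ^ (m + 1)
  have hb : 0 < b := by positivity
  set v := volume (Metric.ball (0 : EuclideanSpace ℝ (Fin (m + 1))) 1)
  have hv : v ≠ 0 := (Metric.measure_ball_pos _ _ one_pos).ne'
  have hvt : v ≠ ⊤ := measure_ball_lt_top.ne
  have hlim : Filter.Tendsto (fun M : ℝ => ENNReal.ofReal (M ^ (-s) * b) * v)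
      (nhdsWithin 0 (Set.Ioi 0)) (nhds ⊤) := by
    have h1 := (tendsto_rpow_neg_nhdsGT_zero (neg_lt_zero.2 hs0)).atTop_mul_const hb
    have h2 := ENNReal.tendsto_ofReal_atTop.comp h1
    have h3 := ENNReal.Tendsto.mul_const (b := v) h2 (Or.inl ENNReal.top_ne_zero)
    rwa [ENNReal.top_mul hv] at h3
  obtain ⟨M₁, hM₁, h⟩ := mem_nhdsGT_iff_exists_Ioo_subset.1 (hlim.eventually_const_lt hC)
  have hM₁' : 0 < M₁ := hM₁
  refine ⟨min M₁ (1 / 2), by positivity, (min_le_right _ _).trans_lt (by norm_num),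
    fun M hM hlt => ?_⟩
  have h1 : C < ENNReal.ofReal (M ^ (-s) * b) * v := h ⟨hM, hlt.trans_le (min_le_left _ _)⟩
  have h2 := h1.trans_le (le_setLIntegral_halfSpace_fracKernel hs0 hM)
  rw [← iSup_setLIntegral_truncKernel, lt_iSup_iff] at h2
  obtain ⟨N₀, hN₀⟩ := h2
  exact ⟨N₀, fun N hN => hN₀.le.trans (lintegral_mono fun z => truncKernel_mono z hN)⟩

end Blowup

/-! ### Reflection in a horizontal hyperplane, and the weight. -/

section Calibration

variable {m : ℕ} {s : ℝ} {M : ℝ} {N : ℕ}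

theorem measurable_last : Measurable fun y : EuclideanSpace ℝ (Fin (m + 1)) => y (Fin.last m) := by
  fun_prop

theorem measurableSet_unitCylinder : MeasurableSet (unitCylinder m) :=
  measurableSet_lt (by fun_prop) measurable_const

theorem measurableSet_slabComplement : MeasurableSet (slabComplement m M) :=
  measurableSet_lt measurable_const (by fun_prop)

theorem exists_reflection_through_height (x : EuclideanSpace ℝ (Fin (m + 1))) :
    ∃ R : EuclideanSpace ℝ (Fin (m + 1)) → EuclideanSpace ℝ (Fin (m + 1)),
      MeasurePreserving R volume volume ∧ (∀ y, ‖x - R y‖ = ‖x - y‖) ∧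
      ∀ y, R y (Fin.last m) = 2 * x (Fin.last m) - y (Fin.last m) := by
  let ρ : EuclideanSpace ℝ (Fin (m + 1)) ≃ₗᵢ[ℝ] EuclideanSpace ℝ (Fin (m + 1)) :=
    LinearIsometryEquiv.piLpCongrRight 2
      (fun i => if i = Fin.last m then LinearIsometryEquiv.neg ℝ else LinearIsometryEquiv.refl ℝ ℝ)
  refine ⟨fun y => x + ρ (-x + y), ?_, ?_, ?_⟩
  · exact (measurePreserving_add_left volume x).comp
      (ρ.measurePreserving.comp (measurePreserving_add_left volume (-x)))
  · intro y
    rw [sub_add_cancel_left, norm_neg, ρ.norm_map, ← norm_neg]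
    congr 1; abel
  · intro y
    simp [ρ]
    ring

/-- Reflection in the hyperplane through x at height x_n preserves the distance to x and carries the
first region into the second. -/
theorem setLIntegral_truncKernel_reflect_le (x : EuclideanSpace ℝ (Fin (m + 1))) :
    ∫⁻ y in {y : EuclideanSpace ℝ (Fin (m + 1)) | |y (Fin.last m)| < |x (Fin.last m)|},
        truncKernel N s (x - y) ≤
      ∫⁻ y in {y : EuclideanSpace ℝ (Fin (m + 1)) | |x (Fin.last m)| < |y (Fin.last m)| ∧
        |y (Fin.last m)| < 3 * |x (Fin.last m)|}, truncKernel N s (x - y) := by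
  obtain ⟨R, hR, hn, hl⟩ := exists_reflection_through_height x
  have hm : MeasurableSet {y : EuclideanSpace ℝ (Fin (m + 1)) |
      |x (Fin.last m)| < |y (Fin.last m)| ∧ |y (Fin.last m)| < 3 * |x (Fin.last m)|} := by
    rw [Set.ofPred_and]
    exact (measurableSet_lt (by fun_prop) (by fun_prop)).inter
      (measurableSet_lt (by fun_prop) (by fun_prop))
  rw [← hR.setLIntegral_comp_preimage hm (by fun_prop)]
  have hk : ∀ y, truncKernel N s (x - R y) = truncKernel N s (x - y) := fun y => by
    simp only [truncKernel, fracKernel, hn]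
  simp_rw [hk]
  refine lintegral_mono_set fun y hy => ?_
  have hy' : |y (Fin.last m)| < |x (Fin.last m)| := hy
  change |x (Fin.last m)| < |R y (Fin.last m)| ∧ |R y (Fin.last m)| < 3 * |x (Fin.last m)|
  rw [hl]
  constructor <;> cases abs_cases (x (Fin.last m)) <;> cases abs_cases (y (Fin.last m)) <;>
    cases abs_cases (2 * x (Fin.last m) - y (Fin.last m)) <;> linarith

end Calibration

noncomputable section

/-- The positive part of the calibrating sign function on the unit cylinder. -/
def calibrationWeight {m : ℕ} (M : ℝ) (x y : EuclideanSpace ℝ (Fin (m + 1))) : ENNReal :=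
  if |x (Fin.last m)| ≤ M then
    if |y (Fin.last m)| ≤ M ∧ ‖horizontalPart x‖ < ‖horizontalPart y‖ then
      ENNReal.ofReal ‖horizontalPart y‖
    else 0
  else if |y (Fin.last m)| < |x (Fin.last m)| then 1 else 0

end

/-! ### The calibration inequality at a single point. -/

section Pointwise

variable {m : ℕ} {s : ℝ} {M : ℝ} {N : ℕ}

theorem calibrationWeight_le_one {x y : EuclideanSpace ℝ (Fin (m + 1))} (hy : y ∈ unitCylinder m) :
    calibrationWeight M x y ≤ 1 := by
  have hy' : ‖horizontalPart y‖ < 1 := hy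
  unfold calibrationWeight
  split_ifs
  · exact ENNReal.ofReal_le_one.2 hy'.le
  all_goals simp

theorem measurable_calibrationWeight :
    Measurable fun q : EuclideanSpace ℝ (Fin (m + 1)) × EuclideanSpace ℝ (Fin (m + 1)) =>
      calibrationWeight M q.1 q.2 := by
  unfold calibrationWeight
  refine Measurable.ite (measurableSet_le (by fun_prop) (by fun_prop)) (Measurable.ite ?_
    (by fun_prop) (by fun_prop)) (Measurable.ite (measurableSet_lt (by fun_prop) (by fun_prop))
    (by fun_prop) (by fun_prop))
  rw [Set.ofPred_and]
  exact (measurableSet_le (by fun_prop) (by fun_prop)).inter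
    (measurableSet_lt (by fun_prop) (by fun_prop))

/-- By Bernoulli r(1 - (r/ρ)^{2m}) ≤ 2m·r(1 - r/ρ) ≤ 2m(ρ - r). The factor r in front cancels the
singular 1/ρ, so the error is linear in d uniformly down to the axis. -/
theorem min_one_le_inversion_add {r ρ d : ℝ} (hr0 : 0 ≤ r) (hrρ : r < ρ)
    (hd : ρ - r ≤ d) :
    min ρ 1 ≤ r * (r / ρ) ^ (2 * m) + (1 + 2 * m) * min 1 d := by
  have hρ : 0 < ρ := hr0.trans_lt hrρ
  have hpow : 0 ≤ r * (r / ρ) ^ (2 * m) := by positivity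
  have hm : (0 : ℝ) ≤ 2 * m := by positivity
  rcases le_total 1 d with h1 | h1
  · rw [min_eq_left h1]
    linarith [min_le_right ρ 1]
  · rw [min_eq_right h1]
    have hb := one_add_mul_le_pow (a := r / ρ - 1) (by linarith [div_nonneg hr0 hρ.le]) (2 * m)
    have e : 1 + (r / ρ - 1) = r / ρ := by ring
    rw [e] at hb
    push_cast at hb
    have h2 : r * (1 - r / ρ) ≤ ρ - r := by
      have : r * (1 - r / ρ) = r / ρ * (ρ - r) := by field_simp
      rw [this]
      exact mul_le_of_le_one_left (by linarith) ((div_le_one hρ).2 hrρ.le)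
    have h3 : r * (1 + 2 * m * (r / ρ - 1)) ≤ r * (r / ρ) ^ (2 * m) :=
      mul_le_mul_of_nonneg_left hb hr0
    have h4 : 2 * m * (r * (1 - r / ρ)) ≤ 2 * m * d := mul_le_mul_of_nonneg_left (h2.trans hd) hm
    nlinarith [min_le_left ρ 1]

/-- Inversion compares the part of the slab outside the cylinder of radius |x'| with the part
inside. Thanks to the weights |y'| and |x'| the error is bounded independently of x, M and N; with
weight 1 it would be of order |x'|^{-s}. -/
theorem setLIntegral_outer_slab_le (hs0 : 0 < s) {x : EuclideanSpace ℝ (Fin (m + 1))} (hx : x ∈ unitCylinder m) :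
    ∫⁻ y in {y : EuclideanSpace ℝ (Fin (m + 1)) | y (Fin.last m) ∈ {b : ℝ | |b| ≤ M} ∧
        ‖horizontalPart x‖ < ‖horizontalPart y‖},
        ENNReal.ofReal (min ‖horizontalPart y‖ 1) * truncKernel N s (x - y) ≤
      ENNReal.ofReal ‖horizontalPart x‖ *
        (∫⁻ y in {y : EuclideanSpace ℝ (Fin (m + 1)) | y (Fin.last m) ∈ {b : ℝ | |b| ≤ M} ∧
          ‖horizontalPart y‖ < ‖horizontalPart x‖}, truncKernel N s (x - y)) +
      ENNReal.ofReal (1 + 2 * m) *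
        ∫⁻ z : EuclideanSpace ℝ (Fin (m + 1)), ENNReal.ofReal (min 1 ‖z‖) * fracKernel s z := by
  set r := ‖horizontalPart x‖ with hr
  have hr0 : 0 ≤ r := norm_nonneg _
  have hr1 : r < 1 := hx
  have hT : MeasurableSet {b : ℝ | |b| ≤ M} := measurableSet_le (by fun_prop) measurable_const
  set P := {y : EuclideanSpace ℝ (Fin (m + 1)) | y (Fin.last m) ∈ {b : ℝ | |b| ≤ M} ∧
        r < ‖horizontalPart y‖} with hP
  have hPm : MeasurableSet P := by
    rw [hP, Set.ofPred_and]
    exact (measurable_last hT).inter (measurableSet_lt (by fun_prop) (by fun_prop))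
  calc ∫⁻ y in P, ENNReal.ofReal (min ‖horizontalPart y‖ 1) * truncKernel N s (x - y)
      ≤ ∫⁻ y in P, (ENNReal.ofReal r * (ENNReal.ofReal ((r / ‖horizontalPart y‖) ^ (2 * m)) *
          truncKernel N s (x - y)) + ENNReal.ofReal (1 + 2 * m) *
            (ENNReal.ofReal (min 1 ‖x - y‖) * fracKernel s (x - y))) := by
        refine setLIntegral_mono' hPm fun y hy => ?_
        have hy2 : r < ‖horizontalPart y‖ := hy.2
        have hd : ‖horizontalPart y‖ - r ≤ ‖x - y‖ := by
          have h1 := norm_horizontalPart_le (y - x)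
          rw [horizontalPart_sub, norm_sub_rev y x] at h1
          exact (norm_sub_norm_le _ _).trans h1
        have h := ENNReal.ofReal_le_ofReal (min_one_le_inversion_add (m := m) hr0 hy2 hd)
        rw [ENNReal.ofReal_add (by positivity) (by positivity), ENNReal.ofReal_mul hr0,
          ENNReal.ofReal_mul (by positivity)] at h
        calc _ ≤ _ := mul_le_mul_left h _
          _ ≤ _ := by
            rw [add_mul, mul_assoc, mul_assoc]
            gcongr
            exact truncKernel_le _
    _ = ENNReal.ofReal r * (∫⁻ y in P, ENNReal.ofReal ((r / ‖horizontalPart y‖) ^ (2 * m)) *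
          truncKernel N s (x - y)) + ENNReal.ofReal (1 + 2 * m) *
            ∫⁻ y in P, ENNReal.ofReal (min 1 ‖x - y‖) * fracKernel s (x - y) := by
        rw [lintegral_add_left (by fun_prop), lintegral_const_mul _ (by fun_prop),
          lintegral_const_mul _ (by fun_prop)]
    _ ≤ _ := by
        refine add_le_add ?_ (mul_le_mul_right ((setLIntegral_le_lintegral _ _).trans ?_) _)
        -- On the axis there is no sphere to invert in, but the coefficient r vanishes there.
        · rcases hr0.eq_or_lt with h0 | h0
          · rw [← h0]; simp
          · refine mul_le_mul_right ?_ _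
            refine lintegral_slab_exterior_inversion_le x h0
              (f := fun ρ => min (ENNReal.ofReal (1 / ρ ^ (((m + 1 : ℕ) : ℝ) + s))) N)
              (by fun_prop) (fun a b ha hab => ?_) hT
            refine min_le_min_right _ (ENNReal.ofReal_le_ofReal ?_)
            have he : 0 ≤ ((m + 1 : ℕ) : ℝ) + s := by positivity
            exact one_div_le_one_div_of_le (Real.rpow_pos_of_pos ha _)
              (Real.rpow_le_rpow ha.le hab he)
        · rw [← lintegral_sub_left_eq_self (fun z => ENNReal.ofReal (min 1 ‖z‖) * fracKernel s z) x]

/-- The terms on the left, apart from δ, are bounded by the outer slab integral with weight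
min(|y'|, 1), since outside Ω this weight is 1. `setLIntegral_outer_slab_le` trades it for the inner
slab, which appears on the right, plus a bounded error. The error and δ are paid by S, all of which
counts with weight 1 on the right. -/
theorem calibration_inequality_of_mem_slab (hs0 : 0 < s) {x : EuclideanSpace ℝ (Fin (m + 1))}
    (hx : x ∈ unitCylinder m) (hxM : |x (Fin.last m)| ≤ M) {δ : ENNReal}
    (hδ : ENNReal.ofReal (1 + 2 * m) *
        (∫⁻ z : EuclideanSpace ℝ (Fin (m + 1)), ENNReal.ofReal (min 1 ‖z‖) * fracKernel s z) + δ ≤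
      ∫⁻ z in {z : EuclideanSpace ℝ (Fin (m + 1)) | 2 * M < z (Fin.last m)}, truncKernel N s z) :
    (∫⁻ y in unitCylinder m, calibrationWeight M x y * truncKernel N s (x - y)) +
      (∫⁻ y in (unitCylinder m)ᶜ \ slabComplement m M, truncKernel N s (x - y)) + δ ≤
    (∫⁻ y in unitCylinder m, calibrationWeight M y x * truncKernel N s (x - y)) +
      ∫⁻ y in slabComplement m M \ unitCylinder m, truncKernel N s (x - y) := by
  have hΩ := measurableSet_unitCylinder (m := m)
  have hS := measurableSet_slabComplement (m := m) (M := M)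
  have hr1 : ‖horizontalPart x‖ < 1 := hx
  have hT : MeasurableSet {b : ℝ | |b| ≤ M} := measurableSet_le (by fun_prop) measurable_const
  set P := {y : EuclideanSpace ℝ (Fin (m + 1)) | y (Fin.last m) ∈ {b : ℝ | |b| ≤ M} ∧
        ‖horizontalPart x‖ < ‖horizontalPart y‖} with hP
  set Q := {y : EuclideanSpace ℝ (Fin (m + 1)) | y (Fin.last m) ∈ {b : ℝ | |b| ≤ M} ∧
          ‖horizontalPart y‖ < ‖horizontalPart x‖} with hQ
  have hPm : MeasurableSet P := by
    rw [hP, Set.ofPred_and]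
    exact (measurable_last hT).inter (measurableSet_lt (by fun_prop) (by fun_prop))
  have hQm : MeasurableSet Q := by
    rw [hQ, Set.ofPred_and]
    exact (measurable_last hT).inter (measurableSet_lt (by fun_prop) (by fun_prop))
  have h1 : (∫⁻ y in unitCylinder m, calibrationWeight M x y * truncKernel N s (x - y)) ≤
      ∫⁻ y in P ∩ unitCylinder m,
        ENNReal.ofReal (min ‖horizontalPart y‖ 1) * truncKernel N s (x - y) := by
    rw [← lintegral_indicator (hPm.inter hΩ), ← lintegral_indicator hΩ]
    refine lintegral_mono fun y => ?_
    by_cases hy : y ∈ unitCylinder m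
    · have hy1 : ‖horizontalPart y‖ < 1 := hy
      by_cases hyP : y ∈ P
      · have hyP' : |y (Fin.last m)| ≤ M ∧ ‖horizontalPart x‖ < ‖horizontalPart y‖ := hyP
        rw [Set.indicator_of_mem hy, Set.indicator_of_mem (Set.mem_inter hyP hy), calibrationWeight, if_pos hxM,
          if_pos hyP', min_eq_left hy1.le]
      · have hyP' : ¬ (|y (Fin.last m)| ≤ M ∧ ‖horizontalPart x‖ < ‖horizontalPart y‖) := hyP
        rw [Set.indicator_of_mem hy, calibrationWeight, if_pos hxM, if_neg hyP', zero_mul]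
        exact zero_le
    · rw [Set.indicator_of_notMem hy]
      exact zero_le
  have h2 : ∫⁻ y in (unitCylinder m)ᶜ \ slabComplement m M, truncKernel N s (x - y) ≤
      ∫⁻ y in P \ unitCylinder m,
        ENNReal.ofReal (min ‖horizontalPart y‖ 1) * truncKernel N s (x - y) := by
    have hsub : (unitCylinder m)ᶜ \ slabComplement m M ⊆ P \ unitCylinder m := by
      rintro y ⟨hy1, hy2⟩
      have hy1' : ¬ ‖horizontalPart y‖ < 1 := hy1
      have hy2' : ¬ M < |y (Fin.last m)| := hy2
      exact ⟨⟨not_lt.1 hy2', hr1.trans_le (not_lt.1 hy1')⟩, hy1⟩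
    refine le_trans (le_of_eq (setLIntegral_congr_fun (hΩ.compl.diff hS) fun y hy => ?_))
      (lintegral_mono_set hsub)
    have hy1' : ¬ ‖horizontalPart y‖ < 1 := hy.1
    simp [min_eq_right (not_lt.1 hy1')]
  have h3 : ENNReal.ofReal ‖horizontalPart x‖ * (∫⁻ y in Q, truncKernel N s (x - y)) +
      ∫⁻ y in slabComplement m M ∩ unitCylinder m, truncKernel N s (x - y) ≤
      ∫⁻ y in unitCylinder m, calibrationWeight M y x * truncKernel N s (x - y) := by
    rw [← lintegral_const_mul _ (by fun_prop), ← lintegral_indicator hQm,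
      ← lintegral_indicator (hS.inter hΩ), ← lintegral_add_left
        ((Measurable.indicator (by fun_prop) hQm)), ← lintegral_indicator hΩ]
    refine lintegral_mono fun y => ?_
    by_cases hyQ : y ∈ Q
    · have hyQ' : |y (Fin.last m)| ≤ M ∧ ‖horizontalPart y‖ < ‖horizontalPart x‖ := hyQ
      have hyS : y ∉ slabComplement m M ∩ unitCylinder m := fun h => (not_lt.2 hyQ'.1) h.1
      have hyΩ : y ∈ unitCylinder m := hyQ'.2.trans hr1
      rw [Set.indicator_of_mem hyQ, Set.indicator_of_notMem hyS, Set.indicator_of_mem hyΩ, add_zero,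
        calibrationWeight, if_pos hyQ'.1, if_pos ⟨hxM, hyQ'.2⟩]
    · rw [Set.indicator_of_notMem hyQ, zero_add]
      by_cases hyS : y ∈ slabComplement m M ∩ unitCylinder m
      · have hyM : M < |y (Fin.last m)| := hyS.1
        rw [Set.indicator_of_mem hyS, Set.indicator_of_mem hyS.2, calibrationWeight,
          if_neg hyM.not_ge, if_pos (hxM.trans_lt hyM), one_mul]
      · rw [Set.indicator_of_notMem hyS]
        exact zero_le
  have h4 : ∫⁻ z in {z : EuclideanSpace ℝ (Fin (m + 1)) | 2 * M < z (Fin.last m)},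
      truncKernel N s z ≤ ∫⁻ y in slabComplement m M, truncKernel N s (x - y) := by
    refine setLIntegral_truncKernel_le_of_translate x hS fun z hz => ?_
    have hz' : 2 * M < z (Fin.last m) := hz
    change M < |x (Fin.last m) + z (Fin.last m)|
    have := (abs_le.1 hxM).1
    exact lt_of_lt_of_le (by linarith) (le_abs_self _)
  have h5 := setLIntegral_outer_slab_le (M := M) (N := N) hs0 hx
  rw [← lintegral_inter_add_sdiff _ P hΩ] at h5
  rw [← lintegral_inter_add_sdiff _ (slabComplement m M) hΩ] at h4
  refine (add_le_add_left ((add_le_add h1 h2).trans h5) δ).trans ?_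
  rw [add_assoc]
  refine (add_le_add_right (hδ.trans h4) _).trans ?_
  rw [← add_assoc]
  exact add_le_add_left h3 _

/-- With t = |x_n|, reflection shows that {|y_n| < t} weighs no more than {t < |y_n| < 3t}. The gain
δ is found in a region this comparison leaves over: {|y_n| ≥ 3t} for t ≤ 2, and for t > 2 the part
of S below height t outside Ω, which is in the reflected slab but absent from the left side. -/
theorem calibration_inequality_of_notMem_slab {x : EuclideanSpace ℝ (Fin (m + 1))}
    (hx : x ∈ unitCylinder m) (hM0 : 0 < M) (hM1 : M < 1) (hxM : M < |x (Fin.last m)|) {δ : ENNReal}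
    (hδ1 : δ ≤ ∫⁻ z in {z : EuclideanSpace ℝ (Fin (m + 1)) | 8 < |z (Fin.last m)|},
      truncKernel N s z)
    (hδ2 : δ ≤ ∫⁻ z in {z : EuclideanSpace ℝ (Fin (m + 1)) | 2 < ‖horizontalPart z‖ ∧
      z (Fin.last m) ∈ Set.Ioo (-1) 0}, truncKernel N s z)
    (hδ3 : δ ≤ ∫⁻ z in {z : EuclideanSpace ℝ (Fin (m + 1)) | 2 < ‖horizontalPart z‖ ∧
      z (Fin.last m) ∈ Set.Ioo 0 1}, truncKernel N s z) :
    (∫⁻ y in unitCylinder m, calibrationWeight M x y * truncKernel N s (x - y)) +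
      (∫⁻ y in (unitCylinder m)ᶜ \ slabComplement m M, truncKernel N s (x - y)) + δ ≤
    (∫⁻ y in unitCylinder m, calibrationWeight M y x * truncKernel N s (x - y)) +
      ∫⁻ y in slabComplement m M \ unitCylinder m, truncKernel N s (x - y) := by
  have hΩ := measurableSet_unitCylinder (m := m)
  have hS := measurableSet_slabComplement (m := m) (M := M)
  have hr1 : ‖horizontalPart x‖ < 1 := hx
  set t := |x (Fin.last m)| with ht
  set L := {y : EuclideanSpace ℝ (Fin (m + 1)) | |y (Fin.last m)| < t} with hL
  set H := {y : EuclideanSpace ℝ (Fin (m + 1)) | t < |y (Fin.last m)|} with hH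
  have hLm : MeasurableSet L := measurableSet_lt (by fun_prop) (by fun_prop)
  have hHm : MeasurableSet H := measurableSet_lt (by fun_prop) (by fun_prop)
  have h1 : (∫⁻ y in unitCylinder m, calibrationWeight M x y * truncKernel N s (x - y)) =
      ∫⁻ y in L ∩ unitCylinder m, truncKernel N s (x - y) := by
    rw [← lintegral_indicator (hLm.inter hΩ), ← lintegral_indicator hΩ]
    refine lintegral_congr fun y => ?_
    by_cases hy : y ∈ unitCylinder m
    · by_cases hyL : y ∈ L
      · have hyL' : |y (Fin.last m)| < |x (Fin.last m)| := hyL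
        rw [Set.indicator_of_mem hy, Set.indicator_of_mem (Set.mem_inter hyL hy), calibrationWeight,
          if_neg hxM.not_ge, if_pos hyL', one_mul]
      · have hyL' : ¬ |y (Fin.last m)| < |x (Fin.last m)| := hyL
        rw [Set.indicator_of_mem hy, Set.indicator_of_notMem (fun h => hyL h.1), calibrationWeight,
          if_neg hxM.not_ge, if_neg hyL', zero_mul]
    · rw [Set.indicator_of_notMem hy, Set.indicator_of_notMem (fun h => hy h.2)]
  have h3 : ∫⁻ y in H ∩ unitCylinder m, truncKernel N s (x - y) ≤
      ∫⁻ y in unitCylinder m, calibrationWeight M y x * truncKernel N s (x - y) := by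
    rw [← lintegral_indicator (hHm.inter hΩ), ← lintegral_indicator hΩ]
    refine lintegral_mono fun y => ?_
    by_cases hy : y ∈ H ∩ unitCylinder m
    · have hyH : t < |y (Fin.last m)| := hy.1
      rw [Set.indicator_of_mem hy, Set.indicator_of_mem hy.2, calibrationWeight,
          if_neg (hxM.trans hyH).not_ge, if_pos hyH, one_mul]
    · rw [Set.indicator_of_notMem hy]
      exact zero_le
  have h4 : ∫⁻ y in H \ unitCylinder m, truncKernel N s (x - y) ≤
      ∫⁻ y in slabComplement m M \ unitCylinder m, truncKernel N s (x - y) := by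
    refine lintegral_mono_set fun y hy => ⟨?_, hy.2⟩
    have hyH : t < |y (Fin.last m)| := hy.1
    exact hxM.trans hyH
  have h5 : ∫⁻ y in H, truncKernel N s (x - y) ≤
      (∫⁻ y in unitCylinder m, calibrationWeight M y x * truncKernel N s (x - y)) +
      ∫⁻ y in slabComplement m M \ unitCylinder m, truncKernel N s (x - y) := by
    rw [← lintegral_inter_add_sdiff _ H hΩ]
    exact add_le_add h3 h4
  have hrefl := setLIntegral_truncKernel_reflect_le (N := N) (s := s) x
  rw [← ht] at hrefl
  have hKL : (unitCylinder m)ᶜ \ slabComplement m M ⊆ L \ unitCylinder m := by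
    rintro y ⟨hy1, hy2⟩
    have hy2' : ¬ M < |y (Fin.last m)| := hy2
    exact ⟨(not_lt.1 hy2').trans_lt hxM, hy1⟩
  rw [h1]
  refine le_trans ?_ h5
  rcases le_or_gt t 2 with ht2 | ht2
  · set B := {y : EuclideanSpace ℝ (Fin (m + 1)) | 3 * t ≤ |y (Fin.last m)|} with hB
    have hBm : MeasurableSet B := measurableSet_le (by fun_prop) (by fun_prop)
    -- For t ≤ 2 and |z_n| > 8 the point x + z has height above 8 - 2 = 6 ≥ 3t.
    have h6 : δ ≤ ∫⁻ y in B, truncKernel N s (x - y) := by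
      refine hδ1.trans (setLIntegral_truncKernel_le_of_translate x hBm fun z hz => ?_)
      have hz' : 8 < |z (Fin.last m)| := hz
      change 3 * t ≤ |x (Fin.last m) + z (Fin.last m)|
      cases abs_cases (x (Fin.last m)) <;> cases abs_cases (z (Fin.last m)) <;>
        cases abs_cases (x (Fin.last m) + z (Fin.last m)) <;> linarith
    rw [← lintegral_inter_add_sdiff _ L hΩ] at hrefl
    have hdisj : Disjoint {y : EuclideanSpace ℝ (Fin (m + 1)) | t < |y (Fin.last m)| ∧
        |y (Fin.last m)| < 3 * t} B := by
      rw [Set.disjoint_left]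
      intro y hy hyB
      have h : |y (Fin.last m)| < 3 * t := hy.2
      have h' : 3 * t ≤ |y (Fin.last m)| := hyB
      linarith
    calc _ ≤ _ := add_le_add ((add_le_add_right (lintegral_mono_set hKL) _).trans hrefl) h6
      _ ≤ _ := by
        rw [← lintegral_union hBm hdisj]
        refine lintegral_mono_set (Set.union_subset (fun y hy => hy.1) fun y hy => ?_)
        have h' : 3 * t ≤ |y (Fin.last m)| := hy
        change t < |y (Fin.last m)|
        linarith
  · set W := (slabComplement m M ∩ L) \ unitCylinder m with hW
    have hWm : MeasurableSet W := (hS.inter hLm).diff hΩ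
    have hmemW : ∀ z : EuclideanSpace ℝ (Fin (m + 1)), 2 < ‖horizontalPart z‖ →
        1 < |x (Fin.last m) + z (Fin.last m)| → |x (Fin.last m) + z (Fin.last m)| < t →
        x + z ∈ W := by
      intro z hz h1 h2
      refine ⟨⟨hM1.trans h1, h2⟩, fun h => ?_⟩
      have h' : ‖horizontalPart x + horizontalPart z‖ < 1 := h
      have h7 := norm_sub_le (horizontalPart x + horizontalPart z) (horizontalPart x)
      rw [add_sub_cancel_left] at h7
      linarith
    have h6 : δ ≤ ∫⁻ y in W, truncKernel N s (x - y) := by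
      -- Move vertically towards height 0 by less than 1: the height stays above 1 > M. A horizontal
      -- move by more than 2 leaves Ω.
      rcases le_total 0 (x (Fin.last m)) with hx0 | hx0
      · refine hδ2.trans (setLIntegral_truncKernel_le_of_translate x hWm fun z hz => ?_)
        obtain ⟨hz1, hz2, hz3⟩ := hz
        have hte : t = x (Fin.last m) := abs_of_nonneg hx0
        rw [hte] at ht2
        have : 0 < x (Fin.last m) + z (Fin.last m) := by linarith
        apply hmemW z hz1 <;> rw [abs_of_pos this] <;> linarith
      · refine hδ3.trans (setLIntegral_truncKernel_le_of_translate x hWm fun z hz => ?_)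
        obtain ⟨hz1, hz2, hz3⟩ := hz
        have hte : t = -x (Fin.last m) := abs_of_nonpos hx0
        rw [hte] at ht2
        have : x (Fin.last m) + z (Fin.last m) < 0 := by linarith
        apply hmemW z hz1 <;> rw [abs_of_neg this] <;> linarith
    have hdisj : Disjoint ((unitCylinder m)ᶜ \ slabComplement m M) W := by
      rw [Set.disjoint_left]
      intro y hy hyW
      exact hy.2 hyW.1.1
    have h7 : (∫⁻ y in (unitCylinder m)ᶜ \ slabComplement m M, truncKernel N s (x - y)) + δ ≤
        ∫⁻ y in L \ unitCylinder m, truncKernel N s (x - y) := by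
      refine (add_le_add_right h6 _).trans ?_
      rw [← lintegral_union hWm hdisj]
      exact lintegral_mono_set (Set.union_subset hKL fun y hy => ⟨hy.1.2, hy.2⟩)
    rw [add_assoc]
    refine (add_le_add_right h7 _).trans ?_
    rw [lintegral_inter_add_sdiff _ L hΩ]
    exact hrefl.trans (lintegral_mono_set fun y hy => hy.1)

end Pointwise

/-! ### From the pointwise inequality to sets. -/

section Key

variable {m : ℕ} {s : ℝ} {M : ℝ} {N : ℕ}

theorem exists_calibration_inequality (hm : 1 ≤ m) (hs0 : 0 < s) (hs1 : s < 1) :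
    ∃ (M₀ : ℝ) (δ : ENNReal), 0 < M₀ ∧ M₀ < 1 ∧ 0 < δ ∧ δ ≠ ⊤ ∧
      ∀ M, 0 < M → M < M₀ →
      ∃ N₀ : ℕ, ∀ N, N₀ ≤ N → ∀ x ∈ unitCylinder m,
    (∫⁻ y in unitCylinder m, calibrationWeight M x y * truncKernel N s (x - y)) +
      (∫⁻ y in (unitCylinder m)ᶜ \ slabComplement m M, truncKernel N s (x - y)) + δ ≤
    (∫⁻ y in unitCylinder m, calibrationWeight M y x * truncKernel N s (x - y)) +
      ∫⁻ y in slabComplement m M \ unitCylinder m, truncKernel N s (x - y) := by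
  have hcyl : ∀ a b : ℝ, IsOpen {z : EuclideanSpace ℝ (Fin (m + 1)) | 2 < ‖horizontalPart z‖ ∧
      z (Fin.last m) ∈ Set.Ioo a b} := by
    intro a b
    rw [Set.ofPred_and]
    exact (isOpen_lt (by fun_prop) (by fun_prop)).inter
      (isOpen_Ioo.preimage (by fun_prop : Continuous fun z : EuclideanSpace ℝ (Fin (m + 1)) =>
        z (Fin.last m)))
  have hpt : ∀ c : ℝ, ∃ z : EuclideanSpace ℝ (Fin (m + 1)), 2 < ‖horizontalPart z‖ ∧
      z (Fin.last m) = c := by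
    intro c
    -- A single horizontal coordinate equal to 3 suffices; this is where m ≥ 1 enters.
    refine ⟨WithLp.toLp 2 (Fin.snoc (fun _ => 3) c), ?_, by simp⟩
    have h := PiLp.norm_apply_le (p := 2) (horizontalPart (WithLp.toLp 2
      (Fin.snoc (fun _ => 3) c : Fin (m + 1) → ℝ))) ⟨0, hm⟩
    have h2 : (horizontalPart (WithLp.toLp 2 (Fin.snoc (fun _ => 3) c : Fin (m + 1) → ℝ)))
        ⟨0, hm⟩ = 3 := by
      change (Fin.snoc (fun _ => 3) c : Fin (m + 1) → ℝ) (Fin.castSucc ⟨0, hm⟩) = 3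
      rw [Fin.snoc_castSucc]
    rw [h2] at h
    norm_num at h
    linarith
  have hpos1 : 0 < ∫⁻ z in {z : EuclideanSpace ℝ (Fin (m + 1)) | 8 < |z (Fin.last m)|},
      truncKernel 1 s z := by
    obtain ⟨z, -, hz⟩ := hpt 9
    refine setLIntegral_truncKernel_pos le_rfl (isOpen_lt (by fun_prop) (by fun_prop)) ⟨z, ?_⟩ ?_
    · change 8 < |z (Fin.last m)|
      rw [hz]; norm_num
    · intro h
      have h' : (8 : ℝ) < |(0 : EuclideanSpace ℝ (Fin (m + 1))) (Fin.last m)| := h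
      norm_num at h'
  have hpos2 : ∀ a b : ℝ, a < b → 0 < ∫⁻ z in {z : EuclideanSpace ℝ (Fin (m + 1)) |
      2 < ‖horizontalPart z‖ ∧ z (Fin.last m) ∈ Set.Ioo a b}, truncKernel 1 s z := by
    intro a b hab
    obtain ⟨z, hz1, hz2⟩ := hpt ((a + b) / 2)
    refine setLIntegral_truncKernel_pos le_rfl (hcyl a b) ⟨z, hz1, ?_⟩ ?_
    · rw [hz2]; constructor <;> linarith
    · intro h
      have h' : 2 < ‖horizontalPart (0 : EuclideanSpace ℝ (Fin (m + 1)))‖ := h.1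
      have h0 : horizontalPart (0 : EuclideanSpace ℝ (Fin (m + 1))) = 0 := rfl
      rw [h0] at h'
      norm_num at h'
  set d₁ := ∫⁻ z in {z : EuclideanSpace ℝ (Fin (m + 1)) | 8 < |z (Fin.last m)|}, truncKernel 1 s z
  set d₂ := ∫⁻ z in {z : EuclideanSpace ℝ (Fin (m + 1)) | 2 < ‖horizontalPart z‖ ∧
      z (Fin.last m) ∈ Set.Ioo (-1 : ℝ) 0}, truncKernel 1 s z with hd₂
  set d₃ := ∫⁻ z in {z : EuclideanSpace ℝ (Fin (m + 1)) | 2 < ‖horizontalPart z‖ ∧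
      z (Fin.last m) ∈ Set.Ioo (0 : ℝ) 1}, truncKernel 1 s z with hd₃
  -- The three gains are measured with truncation level 1, so they bound those for every N ≥ 1 and
  -- do not depend on M. The 1 keeps δ finite.
  set δ := min (min 1 d₁) (min d₂ d₃) with hδ
  have hδ1 : δ ≤ 1 := (min_le_left _ _).trans (min_le_left _ _)
  have hδpos : 0 < δ := lt_min (lt_min one_pos hpos1)
    (lt_min (hpos2 _ _ (by norm_num)) (hpos2 _ _ (by norm_num)))
  set C := ENNReal.ofReal (1 + 2 * m) *
    (∫⁻ z : EuclideanSpace ℝ (Fin (m + 1)), ENNReal.ofReal (min 1 ‖z‖) * fracKernel s z) + δ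
  have hC : C < ⊤ := ENNReal.add_lt_top.2 ⟨ENNReal.mul_lt_top ENNReal.ofReal_lt_top
    (lintegral_min_one_norm_mul_fracKernel_lt_top (by omega) hs0 hs1), hδ1.trans_lt ENNReal.one_lt_top⟩
  obtain ⟨M₀, hM₀, hM₁, hM⟩ := exists_forall_lt_setLIntegral_halfSpace_truncKernel (m := m) hs0 hC
  refine ⟨M₀, δ, hM₀, hM₁, hδpos, (hδ1.trans_lt ENNReal.one_lt_top).ne, fun M hMpos hMlt => ?_⟩
  obtain ⟨N₀, hN₀⟩ := hM M hMpos hMlt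
  refine ⟨max N₀ 1, fun N hN x hx => ?_⟩
  have hN1 : 1 ≤ N := (le_max_right _ _).trans hN
  have hmono : ∀ W : Set (EuclideanSpace ℝ (Fin (m + 1))),
      ∫⁻ z in W, truncKernel 1 s z ≤ ∫⁻ z in W, truncKernel N s z :=
    fun W => lintegral_mono fun z => truncKernel_mono z hN1
  rcases le_or_gt |x (Fin.last m)| M with hxM | hxM
  · exact calibration_inequality_of_mem_slab hs0 hx hxM (hN₀ N ((le_max_left _ _).trans hN))
  · exact calibration_inequality_of_notMem_slab hx hMpos (hMlt.trans hM₁) hxM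
      (((min_le_left _ _).trans (min_le_right _ _)).trans (hmono _))
      (((min_le_right _ _).trans (min_le_left _ _)).trans (hmono _))
      (((min_le_right _ _).trans (min_le_right _ _)).trans (hmono _))

theorem iSup_truncated_interaction (A B : Set (EuclideanSpace ℝ (Fin m))) :
    ⨆ N, ∫⁻ x in A, ∫⁻ y in B, truncKernel N s (x - y) = interaction s A B := by
  rw [interaction_eq, ← lintegral_iSup (fun N => Measurable.lintegral_prod_right' (f := fun q :
      EuclideanSpace ℝ (Fin m) × EuclideanSpace ℝ (Fin m) => truncKernel N s (q.1 - q.2))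
      (by fun_prop)) (fun a b hab x => lintegral_mono fun y => truncKernel_mono _ hab)]
  refine lintegral_congr fun x => ?_
  dsimp only
  rw [← lintegral_iSup (f := fun N y => truncKernel N s (x - y)) (fun N => by fun_prop)
    (fun a b hab y => truncKernel_mono _ hab)]
  simp_rw [iSup_truncKernel]

theorem lintegral_union_of_nullMeasurableSet {α : Type*} [MeasurableSpace α] {μ : Measure α}
    {f : α → ENNReal} {A B : Set α} (hB : NullMeasurableSet B μ) (h : Disjoint A B) :
    ∫⁻ a in A ∪ B, f a ∂μ = ∫⁻ a in A, f a ∂μ + ∫⁻ a in B, f a ∂μ := by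
  rw [Measure.restrict_union₀ h.aedisjoint hB, lintegral_add_measure]

/-- Integrate the pointwise inequality over G. The contributions of G × G on the two sides agree
after exchanging the variables and can be cancelled, being finite for the truncated kernel and |G| <
∞. What remains of the weight on the right is at most 1. -/
theorem interaction_add_le_of_calibration {δ : ENNReal} {N₀ : ℕ}
    (h : ∀ N, N₀ ≤ N → ∀ x ∈ unitCylinder m,
      (∫⁻ y in unitCylinder m, calibrationWeight M x y * truncKernel N s (x - y)) +
        (∫⁻ y in (unitCylinder m)ᶜ \ slabComplement m M, truncKernel N s (x - y)) + δ ≤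
      (∫⁻ y in unitCylinder m, calibrationWeight M y x * truncKernel N s (x - y)) +
        ∫⁻ y in slabComplement m M \ unitCylinder m, truncKernel N s (x - y))
    {G : Set (EuclideanSpace ℝ (Fin (m + 1)))} (hG : NullMeasurableSet G volume)
    (hGΩ : G ⊆ unitCylinder m) (hfin : volume G < ⊤) :
    interaction s G ((unitCylinder m)ᶜ \ slabComplement m M) + δ * volume G ≤
      interaction s G (unitCylinder m \ G) + interaction s G (slabComplement m M \ unitCylinder m) := by
  have hmeas : ∀ N, Measurable fun q : EuclideanSpace ℝ (Fin (m + 1)) ×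
      EuclideanSpace ℝ (Fin (m + 1)) => truncKernel N s (q.1 - q.2) := fun N => by fun_prop
  have hint : ∀ (N : ℕ) (B : Set (EuclideanSpace ℝ (Fin (m + 1)))),
      Measurable fun x => ∫⁻ y in B, truncKernel N s (x - y) :=
    fun N B => (hmeas N).lintegral_prod_right'
  have hw : ∀ N, Measurable fun q : EuclideanSpace ℝ (Fin (m + 1)) ×
      EuclideanSpace ℝ (Fin (m + 1)) => calibrationWeight M q.1 q.2 * truncKernel N s (q.1 - q.2) :=
    fun N => measurable_calibrationWeight.mul (hmeas N)
  have hw' : ∀ N, Measurable fun q : EuclideanSpace ℝ (Fin (m + 1)) ×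
      EuclideanSpace ℝ (Fin (m + 1)) => calibrationWeight M q.2 q.1 * truncKernel N s (q.1 - q.2) :=
    fun N => (measurable_calibrationWeight.comp measurable_swap).mul (hmeas N)
  have key : ∀ N, N₀ ≤ N → (∫⁻ x in G, ∫⁻ y in (unitCylinder m)ᶜ \ slabComplement m M,
      truncKernel N s (x - y)) + δ * volume G ≤
      interaction s G (unitCylinder m \ G) +
        interaction s G (slabComplement m M \ unitCylinder m) := by
    intro N hN
    set c := ∫⁻ x in G, ∫⁻ y in G, calibrationWeight M x y * truncKernel N s (x - y)
    have hswap : ∫⁻ x in G, ∫⁻ y in G, calibrationWeight M y x * truncKernel N s (x - y) = c := by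
      rw [lintegral_lintegral_swap (hw' N).aemeasurable]
      exact lintegral_congr fun x => lintegral_congr fun y => by rw [truncKernel_sub_comm]
    have hcfin : c ≠ ⊤ := by
      have : c ≤ ∫⁻ x in G, ∫⁻ y in G, (N : ENNReal) := by
        refine lintegral_mono fun x => ?_
        refine lintegral_mono_ae ?_
        filter_upwards [ae_restrict_mem₀ hG] with y hy
        calc _ ≤ 1 * (N : ENNReal) :=
              mul_le_mul' (calibrationWeight_le_one (hGΩ hy)) (truncKernel_le_natCast _)
          _ = N := one_mul _
      refine (this.trans_lt ?_).ne
      rw [setLIntegral_const, setLIntegral_const]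
      exact ENNReal.mul_lt_top (ENNReal.mul_lt_top (ENNReal.natCast_lt_top N) hfin) hfin
    have hineq : ∫⁻ x in G,
        ((∫⁻ y in unitCylinder m, calibrationWeight M x y * truncKernel N s (x - y)) +
        (∫⁻ y in (unitCylinder m)ᶜ \ slabComplement m M, truncKernel N s (x - y)) + δ) ≤
      ∫⁻ x in G, ((∫⁻ y in unitCylinder m, calibrationWeight M y x * truncKernel N s (x - y)) +
        ∫⁻ y in slabComplement m M \ unitCylinder m, truncKernel N s (x - y)) := by
      refine lintegral_mono_ae ?_
      filter_upwards [ae_restrict_mem₀ hG] with x hx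
      exact h N hN x (hGΩ hx)
    rw [lintegral_add_right _ measurable_const, lintegral_add_right _ (hint N _),
      lintegral_add_right _ (hint N _), setLIntegral_const] at hineq
    have h1 : c ≤ ∫⁻ x in G, ∫⁻ y in unitCylinder m,
        calibrationWeight M x y * truncKernel N s (x - y) :=
      lintegral_mono fun x => lintegral_mono_set hGΩ
    have h2 : ∫⁻ x in G, ∫⁻ y in unitCylinder m,
        calibrationWeight M y x * truncKernel N s (x - y) ≤
        c + interaction s G (unitCylinder m \ G) := by
      have hsplit : ∀ x, ∫⁻ y in unitCylinder m,
          calibrationWeight M y x * truncKernel N s (x - y) =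
          (∫⁻ y in unitCylinder m \ G, calibrationWeight M y x * truncKernel N s (x - y)) +
          ∫⁻ y in G, calibrationWeight M y x * truncKernel N s (x - y) := fun x => by
        rw [← lintegral_union_of_nullMeasurableSet hG Set.disjoint_sdiff_left,
          Set.sdiff_union_of_subset hGΩ]
      simp_rw [hsplit]
      rw [lintegral_add_right _ (hw' N).lintegral_prod_right', hswap, add_comm]
      refine add_le_add_right (lintegral_mono_ae ?_) _
      filter_upwards [ae_restrict_mem₀ hG] with x hx
      refine lintegral_mono fun y => ?_
      calc _ ≤ 1 * fracKernel s (x - y) :=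
            mul_le_mul' (calibrationWeight_le_one (hGΩ hx)) (truncKernel_le _)
        _ = _ := one_mul _
    have h3 : ∫⁻ x in G, ∫⁻ y in slabComplement m M \ unitCylinder m, truncKernel N s (x - y) ≤
        interaction s G (slabComplement m M \ unitCylinder m) :=
      lintegral_mono fun x => lintegral_mono fun y => truncKernel_le _
    have h4 := (add_le_add_left (add_le_add_left h1 _) _).trans
      (hineq.trans (add_le_add h2 h3))
    rw [add_assoc, add_assoc] at h4
    exact (ENNReal.add_le_add_iff_left hcfin).1 h4
  -- The right side already carries the full kernel, so only the left side is passed to the limit N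
  -- → ∞.
  rw [← iSup_truncated_interaction, ENNReal.iSup_add]
  refine iSup_le fun N => le_trans ?_ (key (max N N₀) (le_max_right _ _))
  refine add_le_add_left (lintegral_mono fun x => lintegral_mono fun y => ?_) _
  exact truncKernel_mono _ (le_max_left _ _)

end Key

/-! ### Additivity and symmetry of the interaction. -/

section Algebra

variable {n : ℕ} {s : ℝ} {A B C D : Set (EuclideanSpace ℝ (Fin n))}

theorem interaction_mono (h₁ : A ⊆ B) (h₂ : C ⊆ D) : interaction s A C ≤ interaction s B D :=
  (lintegral_mono_set h₁).trans (lintegral_mono fun _ => lintegral_mono_set h₂)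

theorem interaction_comm : interaction s A B = interaction s B A := by
  rw [interaction_eq, interaction_eq, lintegral_lintegral_swap (by fun_prop)]
  exact lintegral_congr fun x => lintegral_congr fun y => fracKernel_sub_comm _ _

theorem interaction_union_left (hB : NullMeasurableSet B volume) (h : Disjoint A B) :
    interaction s (A ∪ B) C = interaction s A C + interaction s B C :=
  lintegral_union_of_nullMeasurableSet hB h

theorem interaction_union_left_le :
    interaction s (A ∪ B) C ≤ interaction s A C + interaction s B C :=
  lintegral_union_le _ _ _

theorem interaction_union_right (hC : NullMeasurableSet C volume) (h : Disjoint B C) :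
    interaction s A (B ∪ C) = interaction s A B + interaction s A C := by
  rw [interaction_comm, interaction_union_left hC h, interaction_comm, interaction_comm (A := C)]

theorem interaction_union_right_le :
    interaction s A (B ∪ C) ≤ interaction s A B + interaction s A C := by
  rw [interaction_comm, interaction_comm (A := A), interaction_comm (A := A)]
  exact interaction_union_left_le

theorem interaction_empty_right : interaction s A ∅ = 0 := by
  simp [interaction]

end Algebra

/-! ### Perimeter comparisons in the cylinder. -/

section Cylinder

variable {m : ℕ} {s : ℝ} {M : ℝ}

theorem convex_unitCylinder : Convex ℝ (unitCylinder m) := by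
  intro x hx y hy a b ha hb hab
  have hx' : ‖horizontalPart x‖ < 1 := hx
  have hy' : ‖horizontalPart y‖ < 1 := hy
  change ‖horizontalPart (a • x + b • y)‖ < 1
  have := (convex_ball (0 : EuclideanSpace ℝ (Fin m)) 1) (mem_ball_zero_iff.2 hx')
    (mem_ball_zero_iff.2 hy') ha hb hab
  exact mem_ball_zero_iff.1 this

theorem isOpen_unitCylinder : IsOpen (unitCylinder m) := isOpen_lt (by fun_prop) continuous_const

theorem isOpen_slabComplement : IsOpen (slabComplement m M) :=
  isOpen_lt continuous_const (by fun_prop)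

/-- Filling in the cylinder produces a minimizer. -/
theorem isSMinimizer_unitCylinder_union
    (hkey : ∀ G : Set (EuclideanSpace ℝ (Fin (m + 1))), NullMeasurableSet G volume →
      G ⊆ unitCylinder m → volume G < ⊤ →
      interaction s G ((unitCylinder m)ᶜ \ slabComplement m M) ≤
        interaction s G (unitCylinder m \ G) +
          interaction s G (slabComplement m M \ unitCylinder m)) :
    IsSMinimizer s (unitCylinder m) (unitCylinder m ∪ slabComplement m M) := by
  have hΩ := measurableSet_unitCylinder (m := m)
  have hS := measurableSet_slabComplement (m := m) (M := M)
  refine ⟨(hΩ.union hS).nullMeasurableSet, fun U hU hb _ hUΩ F hF hFE => ?_⟩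
  set E := unitCylinder m ∪ slabComplement m M with hE
  set K := (unitCylinder m)ᶜ \ slabComplement m M with hK
  have hUE : U ⊆ E := hUΩ.trans Set.subset_union_left
  have hEc : Eᶜ = K := by rw [hE, Set.compl_union]; rfl
  have hFU : ∀ x, x ∉ U → (x ∈ F ↔ x ∈ E) := fun x hx =>
    ⟨fun h => (hFE.subset ⟨h, hx⟩).1, fun h => (hFE.superset ⟨h, hx⟩).1⟩
  have hUm := hU.measurableSet.nullMeasurableSet (μ := volume)
  set G := U \ F with hG
  have hGm : NullMeasurableSet G volume := hUm.diff hF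
  have hk := hkey G hGm (Set.sdiff_subset.trans hUΩ)
    ((measure_mono Set.sdiff_subset).trans_lt hb.measure_lt_top)
  have hEP : sPerimeter s E U ≤ interaction s (F ∩ U) K + interaction s G K := by
    have h1 : E ∩ U = U := Set.inter_eq_right.2 hUE
    have h2 : U ∩ K = ∅ := by
      ext x
      simp only [Set.mem_inter_iff, Set.mem_empty_iff_false, iff_false, not_and]
      exact fun hx hxK => hxK.1 (hUΩ hx)
    rw [sPerimeter, hEc, h1, h2, interaction_empty_right, add_zero]
    refine le_trans (interaction_mono (fun x hx => ?_) subset_rfl) interaction_union_left_le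
    by_cases hxF : x ∈ F
    exacts [Or.inl ⟨hxF, hx⟩, Or.inr ⟨hx, hxF⟩]
  have hKG : Disjoint K G := Set.disjoint_left.2 fun x hx hxG => hx.1 (hUΩ hxG.1)
  have h3 : interaction s (F ∩ U) K + interaction s (F ∩ U) G ≤ interaction s (F ∩ U) Fᶜ := by
    rw [← interaction_union_right hGm hKG]
    refine interaction_mono subset_rfl (Set.union_subset (fun x hx hxF => ?_) fun x hx => hx.2)
    have hxE : x ∉ E := by rw [← hEc] at hx; exact hx
    exact hxE ((hFU x fun hxU => hxE (hUE hxU)).1 hxF)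
  have h4 : interaction s (F ∩ Uᶜ) (U ∩ Fᶜ) = interaction s (F ∩ Uᶜ) G := rfl
  -- Both targets are contained in F: within U this is the definition of G, and outside U the sets F
  -- and E agree.
  have h5 : interaction s G (unitCylinder m \ G) +
      interaction s G (slabComplement m M \ unitCylinder m) ≤
      interaction s (F ∩ U) G + interaction s (F ∩ Uᶜ) G := by
    rw [← interaction_union_right (hS.diff hΩ).nullMeasurableSet
      (Set.disjoint_left.2 fun x hx hx' => hx'.2 hx.1), interaction_comm]
    refine le_trans (interaction_mono (fun x hx => ?_) subset_rfl) interaction_union_left_le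
    by_cases hxU : x ∈ U
    · refine Or.inl ⟨?_, hxU⟩
      by_contra hxF
      rcases hx with hx | hx
      · exact hx.2 ⟨hxU, hxF⟩
      · exact hx.2 (hUΩ hxU)
    · refine Or.inr ⟨(hFU x hxU).2 ?_, hxU⟩
      rcases hx with hx | hx
      exacts [Or.inl hx.1, Or.inr hx.1]
  calc sPerimeter s E U ≤ interaction s (F ∩ U) K + interaction s G K := hEP
    _ ≤ interaction s (F ∩ U) K + (interaction s (F ∩ U) G + interaction s (F ∩ Uᶜ) G) :=
        add_le_add_right (hk.trans h5) _
    _ ≤ sPerimeter s F U := by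
        rw [← add_assoc, sPerimeter, h4]
        exact add_le_add_left h3 _

/-- Comparison of a minimizer with the competitor obtained by filling in `U`. -/
theorem mul_volume_le_of_isSMinimizer {δ : ENNReal} (hs0 : 0 < s) (hs1 : s < 1)
    (hkey : ∀ G : Set (EuclideanSpace ℝ (Fin (m + 1))), NullMeasurableSet G volume →
      G ⊆ unitCylinder m → volume G < ⊤ →
      interaction s G ((unitCylinder m)ᶜ \ slabComplement m M) + δ * volume G ≤
        interaction s G (unitCylinder m \ G) +
          interaction s G (slabComplement m M \ unitCylinder m))
    {E U : Set (EuclideanSpace ℝ (Fin (m + 1)))} (hE : IsSMinimizer s (unitCylinder m) E)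
    (hEΩ : E \ unitCylinder m = slabComplement m M \ unitCylinder m)
    (hU : IsOpen U) (hUc : Convex ℝ U) (hb : Bornology.IsBounded U) (hUΩ : U ⊆ unitCylinder m) :
    δ * volume (U \ E) ≤ 2 * interaction s (U \ E) ((unitCylinder m \ E) \ U) := by
  have hΩ := measurableSet_unitCylinder (m := m)
  have hS := measurableSet_slabComplement (m := m) (M := M)
  have hEm := hE.1
  have hUm := hU.measurableSet.nullMeasurableSet (μ := volume)
  set K := (unitCylinder m)ᶜ \ slabComplement m M with hK
  set G := U \ E with hG
  set T := (unitCylinder m \ E) \ U with hT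
  set D := (E ∪ U)ᶜ with hD
  have hGm : NullMeasurableSet G volume := hUm.diff hEm
  have hTm : NullMeasurableSet T volume := (hΩ.nullMeasurableSet.diff hEm).diff hUm
  have hDK : D ⊆ K ∪ T := by
    intro x hx
    have hxE : x ∉ E := fun h => hx (Or.inl h)
    have hxU : x ∉ U := fun h => hx (Or.inr h)
    by_cases hxΩ : x ∈ unitCylinder m
    · exact Or.inr ⟨⟨hxΩ, hxE⟩, hxU⟩
    · exact Or.inl ⟨hxΩ, fun h => hxE (hEΩ.superset ⟨h, hxΩ⟩).1⟩
  have hfin : interaction s U Uᶜ < ⊤ :=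
    hUc.interaction_compl_lt_top (by omega) hs0 hs1 hU hb
  have hDfin : interaction s (E ∩ U) D ≠ ⊤ :=
    ((interaction_mono Set.inter_subset_right fun x (hx : x ∈ D) hxU => hx (Or.inr hxU)).trans_lt hfin).ne
  have hKfin : interaction s G K ≠ ⊤ :=
    ((interaction_mono Set.sdiff_subset fun x hx hxU => hx.1 (hUΩ hxU)).trans_lt hfin).ne
  have hmin := hE.2 U hU hb (hUc.hasLipschitzBoundary hU) hUΩ (E ∪ U) (hEm.union hUm)
    Set.union_sdiff_right
  have h1 : sPerimeter s (E ∪ U) U ≤ interaction s (E ∩ U) D + interaction s G D := by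
    have e1 : (E ∪ U) ∩ U = U := Set.inter_eq_right.2 Set.subset_union_right
    have e2 : U ∩ (E ∪ U)ᶜ = ∅ := by
      ext x
      simp only [Set.mem_inter_iff, Set.mem_empty_iff_false, iff_false, not_and]
      exact fun hx hx' => hx' (Or.inr hx)
    rw [sPerimeter, e1, e2, interaction_empty_right, add_zero]
    refine le_trans (interaction_mono (fun x hx => ?_) subset_rfl) interaction_union_left_le
    by_cases hxE : x ∈ E
    exacts [Or.inl ⟨hxE, hx⟩, Or.inr ⟨hx, hxE⟩]
  have h2 : interaction s (E ∩ U) D + interaction s E G ≤ sPerimeter s E U := by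
    have e1 : interaction s (E ∩ U) D + interaction s (E ∩ U) G ≤ interaction s (E ∩ U) Eᶜ := by
      rw [← interaction_union_right hGm
        (Set.disjoint_left.2 fun x (hx : x ∈ D) hxG => hx (Or.inr hxG.1))]
      exact interaction_mono subset_rfl (Set.union_subset (fun x hx hxE => hx (Or.inl hxE))
        fun x hx => hx.2)
    have e2 : interaction s E G ≤ interaction s (E ∩ U) G + interaction s (E ∩ Uᶜ) G := by
      refine le_trans (interaction_mono (fun x hx => ?_) subset_rfl) interaction_union_left_le
      by_cases hxU : x ∈ U
      exacts [Or.inl ⟨hx, hxU⟩, Or.inr ⟨hx, hxU⟩]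
    calc _ ≤ _ := add_le_add_right e2 _
      _ ≤ _ := by
        rw [← add_assoc]
        exact add_le_add_left e1 _
  -- Minimality against E ∪ U, after cancelling the finite interaction of E ∩ U with D. The points
  -- of D in Ω form T, those outside Ω lie in K by the exterior datum.
  have h3 : interaction s E G ≤ interaction s G K + interaction s G T :=
    ((ENNReal.add_le_add_iff_left hDfin).1 (h2.trans (hmin.trans h1))).trans
      ((interaction_mono subset_rfl hDK).trans interaction_union_right_le)
  have hk := hkey G hGm (Set.sdiff_subset.trans hUΩ)
    ((measure_mono Set.sdiff_subset).trans_lt hb.measure_lt_top)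
  have h4 : interaction s G (unitCylinder m \ G) +
      interaction s G (slabComplement m M \ unitCylinder m) ≤
      interaction s G E + interaction s G T := by
    rw [← interaction_union_right (hS.diff hΩ).nullMeasurableSet
      (Set.disjoint_left.2 fun x hx hx' => hx'.2 hx.1)]
    refine le_trans (interaction_mono subset_rfl (fun x hx => ?_)) interaction_union_right_le
    by_cases hxE : x ∈ E
    · exact Or.inl hxE
    · rcases hx with hx | hx
      · exact Or.inr ⟨⟨hx.1, hxE⟩, fun hxU => hx.2 ⟨hxU, hxE⟩⟩
      · exact absurd (hEΩ.superset hx).1 hxE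
  rw [interaction_comm] at h3
  -- The interaction of G with T enters once from the calibration and once from minimality, hence
  -- the factor 2.
  have h5 := hk.trans (h4.trans (add_le_add_left h3 _))
  rw [add_assoc, ← two_mul] at h5
  exact (ENNReal.add_le_add_iff_left hKfin).1 h5

end Cylinder

/-! ### Averaging over heights, and doubling of the volume. -/

section Growth

variable {m : ℕ} {s : ℝ} {M : ℝ}

/-- The part of the unit cylinder at height less than `R`. -/
def truncatedCylinder (m : ℕ) (R : ℝ) : Set (EuclideanSpace ℝ (Fin (m + 1))) :=
  unitCylinder m ∩ {x | |x (Fin.last m)| < R}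

theorem isOpen_truncatedCylinder (R : ℝ) : IsOpen (truncatedCylinder m R) :=
  isOpen_unitCylinder.inter (isOpen_lt (by fun_prop) (by fun_prop))

theorem convex_truncatedCylinder (R : ℝ) : Convex ℝ (truncatedCylinder m R) := by
  refine convex_unitCylinder.inter fun x hx y hy a b ha hb hab => ?_
  have hx' : |x (Fin.last m)| < R := hx
  have hy' : |y (Fin.last m)| < R := hy
  rw [abs_lt] at hx' hy'
  have := (convex_Ioo (-R) R) hx' hy' ha hb hab
  change |(a • x + b • y) (Fin.last m)| < R
  rw [abs_lt]
  simpa using this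

theorem truncatedCylinder_subset_ball (R : ℝ) :
    truncatedCylinder m R ⊆ Metric.ball 0 (1 + R) := by
  rintro x ⟨hx1, hx2⟩
  have hx1' : ‖horizontalPart x‖ < 1 := hx1
  have hx2' : |x (Fin.last m)| < R := hx2
  rw [mem_ball_zero_iff]
  have h := norm_sq_eq_horizontalPart x
  rw [← sq_abs (x (Fin.last m))] at h
  have h1 := norm_nonneg (horizontalPart x)
  have h2 := abs_nonneg (x (Fin.last m))
  have : ‖x‖ ≤ ‖horizontalPart x‖ + |x (Fin.last m)| :=
    abs_le_of_sq_le_sq' (by nlinarith) (by positivity) |>.2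
  linarith

/-- By Fubini a pair (x, y) counts only for heights R in (|x_n|, |y_n|], and these have measure at
most min(l, ‖x - y‖) = l·min(1, ‖x - y‖/l). -/
theorem lintegral_interaction_truncatedCylinder_le {G : Set (EuclideanSpace ℝ (Fin (m + 1)))}
    (hG : G ⊆ unitCylinder m) (a : ℝ) {l : ℕ} (hl : 1 ≤ l) :
    ∫⁻ R in Set.Ioo a (a + l), interaction s (G ∩ truncatedCylinder m R)
        (G \ truncatedCylinder m R) ≤
      volume (G ∩ truncatedCylinder m (a + l)) * (l * ∫⁻ z : EuclideanSpace ℝ (Fin (m + 1)),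
        ENNReal.ofReal (min 1 (‖z‖ / l)) * fracKernel s z) := by
  have hl0 : (0 : ℝ) < l := by exact_mod_cast hl
  let H : ℝ → EuclideanSpace ℝ (Fin (m + 1)) → EuclideanSpace ℝ (Fin (m + 1)) → ENNReal :=
    fun R x y => (Set.Ioc |x (Fin.last m)| |y (Fin.last m)|).indicator 1 R * fracKernel s (x - y)
  have hHind : ∀ R x y, H R x y = if |x (Fin.last m)| < R ∧ R ≤ |y (Fin.last m)| then
      fracKernel s (x - y) else 0 := by
    intro R x y
    by_cases h : |x (Fin.last m)| < R ∧ R ≤ |y (Fin.last m)|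
    · rw [if_pos h]
      simp only [H]
      rw [Set.indicator_of_mem (show R ∈ Set.Ioc _ _ from h)]
      simp
    · rw [if_neg h]
      simp only [H]
      rw [Set.indicator_of_notMem (show R ∉ Set.Ioc _ _ from h)]
      simp
  have hHm : Measurable fun q : (ℝ × EuclideanSpace ℝ (Fin (m + 1))) ×
      EuclideanSpace ℝ (Fin (m + 1)) => H q.1.1 q.1.2 q.2 := by
    simp_rw [hHind]
    refine Measurable.ite ?_ (by fun_prop) (by fun_prop)
    rw [Set.ofPred_and]
    exact (measurableSet_lt (by fun_prop) (by fun_prop)).inter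
      (measurableSet_le (by fun_prop) (by fun_prop))
  set G' := G ∩ truncatedCylinder m (a + l) with hG'
  have h1 : ∀ R ∈ Set.Ioo a (a + l), interaction s (G ∩ truncatedCylinder m R)
      (G \ truncatedCylinder m R) ≤ ∫⁻ x in G', ∫⁻ y, H R x y := by
    intro R hR
    set A : Set (EuclideanSpace ℝ (Fin (m + 1))) := {x | |x (Fin.last m)| < R} with hA
    set B : Set (EuclideanSpace ℝ (Fin (m + 1))) := {x | R ≤ |x (Fin.last m)|} with hB
    have hAm : MeasurableSet A := measurableSet_lt (by fun_prop) (by fun_prop)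
    have hBm : MeasurableSet B := measurableSet_le (by fun_prop) (by fun_prop)
    have hsub : G ∩ truncatedCylinder m R ⊆ A ∩ G' := by
      rintro x ⟨hxG, hxΩ, hxR⟩
      have hxR' : |x (Fin.last m)| < R := hxR
      exact ⟨hxR, hxG, hxΩ, hxR'.trans hR.2⟩
    have hsub' : G \ truncatedCylinder m R ⊆ B := by
      rintro x ⟨hxG, hx⟩
      change R ≤ |x (Fin.last m)|
      by_contra h
      exact hx ⟨hG hxG, not_le.1 h⟩
    refine (interaction_mono hsub hsub').trans ?_
    rw [interaction_eq, ← setLIntegral_indicator hAm]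
    refine lintegral_mono fun x => ?_
    by_cases hx : x ∈ A
    · rw [Set.indicator_of_mem hx, ← lintegral_indicator hBm]
      refine lintegral_mono fun y => ?_
      rw [hHind]
      by_cases hy : y ∈ B
      · rw [Set.indicator_of_mem hy, if_pos ⟨hx, hy⟩]
      · rw [Set.indicator_of_notMem hy]
        exact zero_le
    · rw [Set.indicator_of_notMem hx]
      exact zero_le
  have h2 : ∀ x y, ∫⁻ R in Set.Ioo a (a + l), H R x y ≤
      l * (ENNReal.ofReal (min 1 (‖x - y‖ / l)) * fracKernel s (x - y)) := by
    intro x y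
    have hb : ∫⁻ R in Set.Ioo a (a + l),
        (Set.Ioc |x (Fin.last m)| |y (Fin.last m)|).indicator (1 : ℝ → ENNReal) R ≤
        l * ENNReal.ofReal (min 1 (‖x - y‖ / l)) := by
      rw [lintegral_indicator_one measurableSet_Ioc, Measure.restrict_apply measurableSet_Ioc]
      have e : (l : ENNReal) * ENNReal.ofReal (min 1 (‖x - y‖ / l)) =
          ENNReal.ofReal (min (l : ℝ) ‖x - y‖) := by
        rw [← ENNReal.ofReal_natCast, ← ENNReal.ofReal_mul hl0.le, mul_min_of_nonneg _ _ hl0.le,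
          mul_one, mul_div_cancel₀ _ hl0.ne']
      rw [e, ENNReal.ofReal_min]
      refine le_min ((measure_mono Set.inter_subset_right).trans ?_)
        ((measure_mono Set.inter_subset_left).trans ?_)
      · rw [Real.volume_Ioo, add_sub_cancel_left]
      · rw [Real.volume_Ioc]
        refine ENNReal.ofReal_le_ofReal ?_
        have := abs_last_le (x - y)
        have h' := abs_sub_abs_le_abs_sub (y (Fin.last m)) (x (Fin.last m))
        rw [abs_sub_comm] at h'
        exact h'.trans this
    simp only [H]
    rw [lintegral_mul_const _ (measurable_one.indicator measurableSet_Ioc), ← mul_assoc]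
    exact mul_le_mul_left hb _
  calc ∫⁻ R in Set.Ioo a (a + l), interaction s (G ∩ truncatedCylinder m R)
        (G \ truncatedCylinder m R)
      ≤ ∫⁻ R in Set.Ioo a (a + l), ∫⁻ x in G', ∫⁻ y, H R x y :=
        setLIntegral_mono' measurableSet_Ioo h1
    _ = ∫⁻ x in G', ∫⁻ R in Set.Ioo a (a + l), ∫⁻ y, H R x y := by
        rw [lintegral_lintegral_swap]
        exact hHm.lintegral_prod_right'.aemeasurable
    _ = ∫⁻ x in G', ∫⁻ y, ∫⁻ R in Set.Ioo a (a + l), H R x y := by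
        refine lintegral_congr fun x => ?_
        rw [lintegral_lintegral_swap]
        exact (hHm.comp (f := fun p : ℝ × EuclideanSpace ℝ (Fin (m + 1)) => ((p.1, x), p.2))
          (by fun_prop)).aemeasurable
    _ ≤ ∫⁻ x in G', (l * ∫⁻ z : EuclideanSpace ℝ (Fin (m + 1)),
        ENNReal.ofReal (min 1 (‖z‖ / l)) * fracKernel s z) := by
        refine lintegral_mono fun x => (lintegral_mono fun y => h2 x y).trans ?_
        rw [lintegral_const_mul _ (by fun_prop), lintegral_sub_left_eq_self
          (fun z => ENNReal.ofReal (min 1 (‖z‖ / l)) * fracKernel s z) x]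
    _ = _ := by rw [setLIntegral_const, mul_comm]

/-- Averaging the hypothesis over R in (a, a + l) with l large makes the volume double from height a
to a + l. The resulting exponential growth contradicts the polynomial volume of truncated cylinders
unless the volume is zero. -/
theorem volume_eq_zero_of_truncatedCylinder_bound (hs0 : 0 < s) (hs1 : s < 1)
    {G : Set (EuclideanSpace ℝ (Fin (m + 1)))} (hG : G ⊆ unitCylinder m) {δ : ENNReal}
    (hδ : 0 < δ) (hδt : δ ≠ ⊤)
    (h : ∀ R, δ * volume (G ∩ truncatedCylinder m R) ≤
      2 * interaction s (G ∩ truncatedCylinder m R) (G \ truncatedCylinder m R)) :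
    volume G = 0 := by
  obtain ⟨l, hl, hΓ⟩ := exists_lintegral_min_one_div_mul_fracKernel_le (n := m + 1) (by omega)
    hs0 hs1 (η := δ / 4) (ENNReal.div_pos hδ.ne' (by norm_num))
  have hl0 : (0 : ℝ) < l := by exact_mod_cast hl
  have hlE : (l : ENNReal) ≠ 0 := by exact_mod_cast (by omega : l ≠ 0)
  set V : ℝ → ENNReal := fun R => volume (G ∩ truncatedCylinder m R) with hV
  have hVmono : ∀ {a b}, a ≤ b → V a ≤ V b := fun {a b} hab =>
    measure_mono fun x hx => ⟨hx.1, hx.2.1, lt_of_lt_of_le hx.2.2 hab⟩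
  -- The bound δ/4 on the averaged kernel and the factor 2 of the hypothesis leave δ V(a) ≤ (δ/2)
  -- V(a + l).
  have hdouble : ∀ a, 2 * V a ≤ V (a + l) := by
    intro a
    have h1 : l * (δ * V a) ≤ l * (δ * (V (a + l) / 2)) := by
      calc l * (δ * V a) = ∫⁻ _ in Set.Ioo a (a + l), δ * V a := by
            rw [setLIntegral_const, Real.volume_Ioo, add_sub_cancel_left, ENNReal.ofReal_natCast,
              mul_comm]
        _ ≤ ∫⁻ R in Set.Ioo a (a + l), 2 * interaction s (G ∩ truncatedCylinder m R)
              (G \ truncatedCylinder m R) :=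
            setLIntegral_mono' measurableSet_Ioo fun R hR =>
              (mul_le_mul_right (hVmono hR.1.le) _).trans (h R)
        _ = 2 * ∫⁻ R in Set.Ioo a (a + l), interaction s (G ∩ truncatedCylinder m R)
              (G \ truncatedCylinder m R) := lintegral_const_mul' _ _ (by norm_num)
        _ ≤ 2 * (V (a + l) * (l * (δ / 4))) := by
            refine mul_le_mul_right
              ((lintegral_interaction_truncatedCylinder_le hG a hl).trans ?_) _
            exact mul_le_mul_right (mul_le_mul_right hΓ _) _
        _ = l * (δ * (V (a + l) / 2)) := by
            have : (4 : ENNReal)⁻¹ = 2⁻¹ * 2⁻¹ := by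
              rw [← ENNReal.mul_inv (by norm_num) (by norm_num)]; norm_num
            rw [div_eq_mul_inv, div_eq_mul_inv, this]
            have h2 : (2 : ENNReal) * 2⁻¹ = 1 := ENNReal.mul_inv_cancel (by norm_num) (by norm_num)
            calc 2 * (V (a + l) * (l * (δ * (2⁻¹ * 2⁻¹)))) =
                (2 * 2⁻¹) * (l * (δ * (V (a + l) * 2⁻¹))) := by ring
              _ = _ := by rw [h2, one_mul]
    have h2 := (ENNReal.mul_le_mul_iff_right hδ.ne' hδt).1
      ((ENNReal.mul_le_mul_iff_right hlE (ENNReal.natCast_ne_top l)).1 h1)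
    calc 2 * V a ≤ 2 * (V (a + l) / 2) := mul_le_mul_right h2 _
      _ = V (a + l) := ENNReal.mul_div_cancel (by norm_num) (by norm_num)
  have hpow : ∀ (a : ℝ) (j : ℕ), 2 ^ j * V a ≤ V (a + j * l) := by
    intro a j
    induction j with
    | zero => simp
    | succ j ih =>
      calc 2 ^ (j + 1) * V a = 2 * (2 ^ j * V a) := by ring
        _ ≤ 2 * V (a + j * l) := mul_le_mul_right ih _
        _ ≤ V (a + j * l + l) := hdouble _
        _ = V (a + (j + 1 : ℕ) * l) := by congr 1; push_cast; ring
  have hVle : ∀ R : ℝ, 0 ≤ R → V R ≤ ENNReal.ofReal ((1 + R) ^ (m + 1)) *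
      volume (Metric.ball (0 : EuclideanSpace ℝ (Fin (m + 1))) 1) := by
    intro R hR
    refine (measure_mono (Set.inter_subset_right.trans (truncatedCylinder_subset_ball R))).trans ?_
    rw [Measure.addHaar_ball volume 0 (by linarith), finrank_euclideanSpace_fin]
  set v := volume (Metric.ball (0 : EuclideanSpace ℝ (Fin (m + 1))) 1) with hv
  have hvt : v ≠ ⊤ := measure_ball_lt_top.ne
  have hzero : ∀ a : ℕ, V a = 0 := by
    intro a
    have hVt : V a ≠ ⊤ := ((hVle a (by positivity)).trans_lt
      (ENNReal.mul_lt_top ENNReal.ofReal_lt_top hvt.lt_top)).ne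
    set C : ℝ := (1 + a + l) ^ (m + 1) * v.toReal with hC
    have hle : ∀ j : ℕ, 1 ≤ j → (V a).toReal ≤ C * ((j : ℝ) ^ (m + 1) / 2 ^ j) := by
      intro j hj
      have hj' : (1 : ℝ) ≤ j := by exact_mod_cast hj
      have h1 := (hpow a j).trans (hVle (a + j * l) (by positivity))
      have h2 := ENNReal.toReal_mono (ENNReal.mul_ne_top ENNReal.ofReal_ne_top hvt) h1
      rw [ENNReal.toReal_mul, ENNReal.toReal_mul, ENNReal.toReal_ofReal (by positivity),
        ENNReal.toReal_pow] at h2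
      have h3 : (1 + (a + j * l) : ℝ) ^ (m + 1) ≤ ((1 + a + l) * j) ^ (m + 1) := by
        refine pow_le_pow_left₀ (by positivity) ?_ _
        have : (0 : ℝ) ≤ a := by positivity
        nlinarith
      have h4 := mul_le_mul_of_nonneg_right h3 (ENNReal.toReal_nonneg (a := v))
      rw [← mul_div_assoc, le_div_iff₀ (by positivity)]
      have h5 : (2 : ENNReal).toReal = 2 := rfl
      rw [h5] at h2
      rw [mul_pow] at h4
      calc (V a).toReal * 2 ^ j = 2 ^ j * (V a).toReal := mul_comm _ _
        _ ≤ _ := h2.trans h4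
        _ = C * j ^ (m + 1) := by rw [hC]; ring
    have hlim : Filter.Tendsto (fun j : ℕ => C * ((j : ℝ) ^ (m + 1) / 2 ^ j)) Filter.atTop
        (nhds 0) := by
      simpa using (tendsto_pow_const_div_const_pow_of_one_lt (m + 1) (one_lt_two (α := ℝ))).const_mul C
    have h0 := ge_of_tendsto hlim (Filter.eventually_atTop.2 ⟨1, hle⟩)
    have h1 : (V a).toReal = 0 := le_antisymm h0 ENNReal.toReal_nonneg
    exact ((ENNReal.toReal_eq_zero_iff _).1 h1).resolve_right hVt
  have hunion : G ⊆ ⋃ a : ℕ, G ∩ truncatedCylinder m a := by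
    intro x hx
    obtain ⟨a, ha⟩ := exists_nat_gt |x (Fin.last m)|
    exact Set.mem_iUnion.2 ⟨a, hx, hG hx, ha⟩
  exact measure_mono_null hunion (measure_iUnion_null hzero)

end Growth

/-! ### Connectedness and normalization of the filled set. -/

section Topology

variable {m : ℕ} {M : ℝ}

/-- A horizontal segment joins any point of S to the axis without changing its height, hence within
S, and the axis lies in the convex cylinder. -/
theorem isConnected_unitCylinder_union : IsConnected (unitCylinder m ∪ slabComplement m M) := by
  have h0 : (0 : EuclideanSpace ℝ (Fin (m + 1))) ∈ unitCylinder m := by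
    change ‖horizontalPart (0 : EuclideanSpace ℝ (Fin (m + 1)))‖ < 1
    have : horizontalPart (0 : EuclideanSpace ℝ (Fin (m + 1))) = 0 := rfl
    simp [this]
  refine ⟨⟨0, Or.inl h0⟩, isPreconnected_of_forall (0 : EuclideanSpace ℝ (Fin (m + 1))) ?_⟩
  intro y hy
  rcases hy with hy | hy
  · exact ⟨unitCylinder m, Set.subset_union_left, h0, hy, convex_unitCylinder.isPreconnected⟩
  have hy' : M < |y (Fin.last m)| := hy
  set p : EuclideanSpace ℝ (Fin (m + 1)) := EuclideanSpace.single (Fin.last m) (y (Fin.last m))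
  have hpl : p (Fin.last m) = y (Fin.last m) := by simp [p]
  have hp : p ∈ unitCylinder m := by
    change ‖horizontalPart p‖ < 1
    have : horizontalPart p = 0 := by
      ext i
      simp [horizontalPart, p, Fin.castSucc_ne_last]
    simp [this]
  have hseg : segment ℝ p y ⊆ slabComplement m M := by
    rintro _ ⟨a, b, -, -, hab, rfl⟩
    change M < |(a • p + b • y) (Fin.last m)|
    have : (a • p + b • y) (Fin.last m) = y (Fin.last m) := by
      simp only [PiLp.add_apply, PiLp.smul_apply, smul_eq_mul]
      rw [hpl, ← add_mul, hab, one_mul]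
    rwa [this]
  refine ⟨unitCylinder m ∪ segment ℝ p y, Set.union_subset_union_right _ hseg, Or.inl h0,
    Or.inr (right_mem_segment ℝ p y), ?_⟩
  exact convex_unitCylinder.isPreconnected.union p hp (left_mem_segment ℝ p y)
    (convex_segment p y).isPreconnected

/-- The set is open, which settles the second condition. For the first, each point of the complement
is a limit of points with |y'| > 1 and |y_n| < M, so every ball around it meets the complement in
positive measure. -/
theorem isNormalizedSet_unitCylinder_union (hM : 0 < M) :
    IsNormalizedSet (unitCylinder m ∪ slabComplement m M) := by
  have hopen : IsOpen (unitCylinder m ∪ slabComplement m M) :=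
    isOpen_unitCylinder.union isOpen_slabComplement
  constructor
  · rintro x ⟨r, hr, hvol⟩
    by_contra hx
    have hx1 : 1 ≤ ‖horizontalPart x‖ := not_lt.1 fun h => hx (Or.inl h)
    have hx2 : |x (Fin.last m)| ≤ M := not_lt.1 fun h => hx (Or.inr h)
    set W : Set (EuclideanSpace ℝ (Fin (m + 1))) :=
      {y | 1 < ‖horizontalPart y‖} ∩ {y | |y (Fin.last m)| < M} with hW
    have hWo : IsOpen W := (isOpen_lt (by fun_prop) (by fun_prop)).inter
      (isOpen_lt (by fun_prop) (by fun_prop))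
    have hWc : x ∈ closure W := by
      -- The vector w is x with its height negated, so x + tw has horizontal part scaled by 1 + t
      -- and height scaled by 1 - t.
      set w := x - EuclideanSpace.single (Fin.last m) (2 * x (Fin.last m)) with hw
      have hw1 : horizontalPart w = horizontalPart x := by
        ext i
        simp [horizontalPart, hw, Fin.castSucc_ne_last]
      have hw2 : w (Fin.last m) = -x (Fin.last m) := by
        simp [hw]
        ring
      have hcont : Filter.Tendsto (fun t : ℝ => x + t • w) (nhdsWithin 0 (Set.Ioi 0)) (nhds x) := by
        have : Continuous fun t : ℝ => x + t • w := by fun_prop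
        simpa using (this.tendsto 0).mono_left nhdsWithin_le_nhds
      refine mem_closure_of_tendsto hcont ?_
      filter_upwards [Ioo_mem_nhdsGT (zero_lt_one (α := ℝ))] with t ht
      refine ⟨?_, ?_⟩
      · change 1 < ‖horizontalPart (x + t • w)‖
        have e : horizontalPart (x + t • w) = (1 + t) • horizontalPart x := by
          rw [horizontalPart_add, horizontalPart_smul, hw1, add_smul, one_smul]
        rw [e, norm_smul, Real.norm_of_nonneg (by linarith [ht.1])]
        nlinarith [ht.1]
      · change |(x + t • w) (Fin.last m)| < M
        have e : (x + t • w) (Fin.last m) = (1 - t) * x (Fin.last m) := by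
          simp only [PiLp.add_apply, PiLp.smul_apply, smul_eq_mul]
          rw [hw2]
          ring
        rw [e, abs_mul, abs_of_pos (by linarith [ht.2])]
        nlinarith [ht.1, ht.2, abs_nonneg (x (Fin.last m))]
    obtain ⟨y, hyB, hyW⟩ := mem_closure_iff.1 hWc _ Metric.isOpen_ball (Metric.mem_ball_self hr)
    have hpos := (Metric.isOpen_ball.inter hWo).measure_pos volume ⟨y, hyB, hyW⟩
    refine hpos.ne' (measure_mono_null ?_ hvol)
    rintro z ⟨hzB, hz1, hz2⟩
    refine ⟨hzB, ?_⟩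
    have hz1 : 1 < ‖horizontalPart z‖ := hz1
    have hz2 : |z (Fin.last m)| < M := hz2
    rintro (h | h)
    · exact (not_lt.2 hz1.le) h
    · exact (not_lt.2 hz2.le) h
  · rintro x ⟨r, hr, hvol⟩ hx
    exact ((Metric.isOpen_ball.inter hopen).measure_pos volume ⟨x, Metric.mem_ball_self hr, hx⟩).ne'
      hvol

end Topology

/-! ### Conclusion. -/

theorem theorem1 (m : ℕ) (hm : 1 ≤ m) (s : ℝ) (hs0 : 0 < s) (hs1 : s < 1) :
    ∃ M₀ : ℝ, 0 < M₀ ∧ M₀ < 1 ∧ ∀ M : ℝ, 0 < M → M < M₀ →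
      (∃ E : Set (EuclideanSpace ℝ (Fin (m + 1))),
        IsSMinimizer s (unitCylinder m) E ∧ IsNormalizedSet E ∧
          E \ unitCylinder m = slabComplement m M \ unitCylinder m) ∧
      ∀ E : Set (EuclideanSpace ℝ (Fin (m + 1))),
        IsSMinimizer s (unitCylinder m) E →
        E \ unitCylinder m = slabComplement m M \ unitCylinder m →
          volume (unitCylinder m \ E) = 0 ∧
          (IsNormalizedSet E → unitCylinder m ⊆ E ∧ IsConnected E) := by
  obtain ⟨M₀, δ, hM₀, hM₁, hδ, hδt, hcal⟩ := exists_calibration_inequality hm hs0 hs1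
  refine ⟨M₀, hM₀, hM₁, fun M hM hMlt => ?_⟩
  obtain ⟨N₀, hN₀⟩ := hcal M hM hMlt
  have hkey : ∀ G : Set (EuclideanSpace ℝ (Fin (m + 1))), NullMeasurableSet G volume →
      G ⊆ unitCylinder m → volume G < ⊤ →
      interaction s G ((unitCylinder m)ᶜ \ slabComplement m M) + δ * volume G ≤
        interaction s G (unitCylinder m \ G) +
          interaction s G (slabComplement m M \ unitCylinder m) :=
    fun G h1 h2 h3 => interaction_add_le_of_calibration hN₀ h1 h2 h3
  refine ⟨⟨unitCylinder m ∪ slabComplement m M, isSMinimizer_unitCylinder_union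
    fun G h1 h2 h3 => le_self_add.trans (hkey G h1 h2 h3),
    isNormalizedSet_unitCylinder_union hM, Set.union_sdiff_left⟩, fun E hE hEΩ => ?_⟩
  have hnull : volume (unitCylinder m \ E) = 0 := by
    refine volume_eq_zero_of_truncatedCylinder_bound hs0 hs1 Set.sdiff_subset hδ hδt fun R => ?_
    have h := mul_volume_le_of_isSMinimizer hs0 hs1 hkey hE hEΩ (isOpen_truncatedCylinder R)
      (convex_truncatedCylinder R) (Metric.isBounded_ball.subset (truncatedCylinder_subset_ball R))
      Set.inter_subset_left
    have e : (unitCylinder m \ E) ∩ truncatedCylinder m R = truncatedCylinder m R \ E := by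
      ext x
      exact ⟨fun hx => ⟨hx.2, hx.1.2⟩, fun hx => ⟨⟨hx.1.1, hx.2⟩, hx.1⟩⟩
    rwa [e]
  refine ⟨hnull, fun hnorm => ?_⟩
  have hsub : unitCylinder m ⊆ E := by
    intro x hx
    obtain ⟨r, hr, hball⟩ := Metric.isOpen_iff.1 isOpen_unitCylinder x hx
    exact hnorm.1 x ⟨r, hr, measure_mono_null (Set.sdiff_subset_sdiff_left hball) hnull⟩
  refine ⟨hsub, ?_⟩
  -- Outside Ω the datum is prescribed pointwise, so E is determined exactly and not only up to null
  -- sets.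
  have hEeq : E = unitCylinder m ∪ slabComplement m M := by
    rw [← Set.union_sdiff_cancel hsub, hEΩ, Set.union_sdiff_self]
  rw [hEeq]
  exact isConnected_unitCylinder_union
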